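/- Let $\mathbf S\in\mathbb R^M$ be a zero-mean Gaussian vector with covariance $\Sigma_S$, let $H$ be a random real $N\times M$ matrix with $E\sum_{i,j}H_{ij}^2<\infty$ (and otherwise arbitrary distribution), and let $\mathbf Z\in\mathbb R^N$ be a zero-mean Gaussian vector with positive definite covariance $\Sigma_Z$ (for example $\Sigma_Z=I$). The fading-paper channel is $\mathbf Y=H(\mathbf X+\mathbf S)+\mathbf Z$, with output $(\mathbf Y,H)$, where $H$, $\mathbf Z$ and the pair $(\mathbf S,\mathbf X)$ are mutually independent. A linear assignment consists of a real $M\times M$ matrix $\mathbf F$ and a zero-mean, square-integrable random vector $\mathbf X\in\mathbb R^M$, which may depend on $\mathbf S$ and need not be Gaussian; one puts $\mathbf U=\mathbf F\mathbf S+\mathbf X$. Its setting is the collection of matrices $\Sigma_S$, $\Sigma_{S,X}=E[\mathbf S\mathbf X^T]$, $\Sigma_X=E[\mathbf X\mathbf X^T]$ and $\mathbf F$, and its rate is $I(\mathbf U;\mathbf Y,H)-I(\mathbf U;\mathbf S)\in[-\infty,\infty)$. Fix a setting, and put $\Sigma_{S,U}=\Sigma_S\mathbf F^T+\Sigma_{S,X}$,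 $\Sigma_U=\mathbf F\Sigma_S\mathbf F^T+\mathbf F\Sigma_{S,X}+\Sigma_{S,X}^T\mathbf F^T+\Sigma_X$, and, for an $N\times M$ matrix $h$, $$G(h)=(\mathbf F\Sigma_S+\mathbf F\Sigma_{S,X}+\Sigma_{S,X}^T+\Sigma_X)h^T,\qquad V(h)=h(\Sigma_S+\Sigma_X+\Sigma_{S,X}+\Sigma_{S,X}^T)h^T+\Sigma_Z,$$ $$K(h)=G(h)V(h)^{-1},\qquad \Sigma_{U|Y,H}(h)=\Sigma_U-G(h)V(h)^{-1}G(h)^T.$$ Assume the following regularity conditions. 1. The expectations $$A=-\tfrac12E\big[(I-K(H)H)^T\Sigma_{U|Y,H}(H)^{-1}(I-K(H)H)\big],\qquad B=-\tfrac12E\big[(\mathbf F-K(H)H)^T\Sigma_{U|Y,H}(H)^{-1}(\mathbf F-K(H)H)\big],$$ $$C=-E\big[(\mathbf F-K(H)H)^T\Sigma_{U|Y,H}(H)^{-1}(I-K(H)H)\big],$$ $$D=-\tfrac12E\big[\log\det(2\pi\Sigma_{U|Y,H}(H))\big]-\tfrac12E\big[\mathrm{tr}\big(K(H)^T\Sigma_{U|Y,H}(H)^{-1}K(H)\Sigma_Z\big)\big]$$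 exist and are finite. 2. The covariance matrix $\begin{pmatrix}\Sigma_S&\Sigma_{S,U}\\ \Sigma_{S,U}^T&\Sigma_U\end{pmatrix}$ of $(\mathbf S,\mathbf U)$ is nonsingular, i.e. positive definite. 3. Only linear assignments are considered for which $\mathbf U$ has a conditional density $q(\mathbf u\mid\mathbf s)$ given $\mathbf S$ with respect to Lebesgue measure. Let the linear-assignment capacity of the setting be the supremum of the rates of all linear assignments with this setting that satisfy condition 3. Then this capacity is achieved by a choice of $\mathbf X$ that is jointly Gaussian with $\mathbf S$: such an assignment with the given setting exists and satisfies condition 3, and every such assignment has a finite rate, equal to the capacity. Moreover, for every linear assignment with this setting that satisfies condition 3, $I(\mathbf U;\mathbf Y,H)<\infty$, so that its rate is well defined, and its rate is at most the capacity. -/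

import Mathlib

open MeasureTheory ProbabilityTheory Matrix
open scoped ENNReal

noncomputable section

namespace FadingPaper

/-- The product (= Borel) `σ`-algebra on real matrices. -/
instance instMeasurableSpaceMatrix {m n : ℕ} : MeasurableSpace (Matrix (Fin m) (Fin n) ℝ) :=
  inferInstanceAs (MeasurableSpace (Fin m → Fin n → ℝ))

/-- Mutual information `I(V; W)` in nats: the Kullback-Leibler divergence of the joint law
from the product of the marginal laws, with values in `[0, ∞]`. -/
def mutualInfo {Ω α β : Type*} [MeasurableSpace Ω] [MeasurableSpace α] [MeasurableSpace β]
    (P : Measure Ω) (V : Ω → α) (W : Ω → β) : ℝ≥0∞ :=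
  InformationTheory.klDiv (P.map fun ω => (V ω, W ω)) ((P.map V).prod (P.map W))

/-- Cross-covariance matrix `Cov(V, W)` of two random vectors. -/
def crossCov {Ω : Type*} [MeasurableSpace Ω] {m n : ℕ} (P : Measure Ω)
    (V : Ω → Fin m → ℝ) (W : Ω → Fin n → ℝ) : Matrix (Fin m) (Fin n) ℝ :=
  Matrix.of fun i j => cov[fun ω => V ω i, fun ω => W ω j; P]

/-- A conditional density `q(w | v)` of `W` given `V` with respect to Lebesgue measure exists. -/
def HasCondDensity {Ω : Type*} [MeasurableSpace Ω] {m n : ℕ} (P : Measure Ω)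
    (W : Ω → Fin n → ℝ) (V : Ω → Fin m → ℝ) : Prop :=
  ∃ q : (Fin m → ℝ) → (Fin n → ℝ) → ℝ≥0∞,
    Measurable (Function.uncurry q) ∧
    (∀ v, ∫⁻ w, q v w = 1) ∧
    P.map (fun ω => (V ω, W ω)) = ((P.map V).prod volume).withDensity (Function.uncurry q)

/-- The setting of a linear assignment: the matrices `Σ_S`, `Σ_{S,X}`, `Σ_X` and `F`. -/
structure Setting (M : ℕ) where
  /-- covariance `Σ_S` of the interference -/
  covS : Matrix (Fin M) (Fin M) ℝ
  /-- cross-covariance `Σ_{S,X} = E[S Xᵀ]` -/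
  covSX : Matrix (Fin M) (Fin M) ℝ
  /-- covariance `Σ_X` of the transmitted signal -/
  covX : Matrix (Fin M) (Fin M) ℝ
  /-- the matrix `F` in `U = F S + X` -/
  F : Matrix (Fin M) (Fin M) ℝ

namespace Setting

variable {M N : ℕ} (σ : Setting M)

/-- `Σ_{S,U}` for `U = F S + X`. -/
def covSU : Matrix (Fin M) (Fin M) ℝ := σ.covS * σ.Fᵀ + σ.covSX

/-- `Σ_U` for `U = F S + X`. -/
def covU : Matrix (Fin M) (Fin M) ℝ :=
  σ.F * σ.covS * σ.Fᵀ + σ.F * σ.covSX + σ.covSXᵀ * σ.Fᵀ + σ.covX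

/-- The covariance matrix of `(S, U)`. -/
def covSUJoint : Matrix (Fin M ⊕ Fin M) (Fin M ⊕ Fin M) ℝ :=
  Matrix.fromBlocks σ.covS σ.covSU σ.covSUᵀ σ.covU

/-- `Cov(U, Y | H = h) = (F Σ_S + F Σ_{S,X} + Σ_{S,X}ᵀ + Σ_X) hᵀ`, where `Y = H (X + S) + Z`. -/
def covUY (h : Matrix (Fin N) (Fin M) ℝ) : Matrix (Fin M) (Fin N) ℝ :=
  (σ.F * σ.covS + σ.F * σ.covSX + σ.covSXᵀ + σ.covX) * hᵀ

/-- `Cov(Y | H = h) = h (Σ_S + Σ_X + Σ_{S,X} + Σ_{S,X}ᵀ) hᵀ + Σ_Z`. -/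
def covY (covZ : Matrix (Fin N) (Fin N) ℝ) (h : Matrix (Fin N) (Fin M) ℝ) :
    Matrix (Fin N) (Fin N) ℝ :=
  h * (σ.covS + σ.covX + σ.covSX + σ.covSXᵀ) * hᵀ + covZ

/-- The matrix `K(h) = Cov(U, Y | H = h) Cov(Y | H = h)⁻¹`. -/
def gain (covZ : Matrix (Fin N) (Fin N) ℝ) (h : Matrix (Fin N) (Fin M) ℝ) :
    Matrix (Fin M) (Fin N) ℝ :=
  σ.covUY h * (σ.covY covZ h)⁻¹

/-- The matrix `Σ_{U|Y,H}(h)`. -/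
def errCov (covZ : Matrix (Fin N) (Fin N) ℝ) (h : Matrix (Fin N) (Fin M) ℝ) :
    Matrix (Fin M) (Fin M) ℝ :=
  σ.covU - σ.covUY h * (σ.covY covZ h)⁻¹ * (σ.covUY h)ᵀ

/-- The matrix `I - K(h) h`. -/
def residX (covZ : Matrix (Fin N) (Fin N) ℝ) (h : Matrix (Fin N) (Fin M) ℝ) :
    Matrix (Fin M) (Fin M) ℝ :=
  1 - σ.gain covZ h * h

/-- The matrix `F - K(h) h`. -/
def residS (covZ : Matrix (Fin N) (Fin N) ℝ) (h : Matrix (Fin N) (Fin M) ℝ) :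
    Matrix (Fin M) (Fin M) ℝ :=
  σ.F - σ.gain covZ h * h

/-- The expectations (over the fading matrix, of law `ν`)
* `A = -1/2 E[(I - K H)ᵀ Σ_{U|Y,H}⁻¹ (I - K H)]`,
* `B = -1/2 E[(F - K H)ᵀ Σ_{U|Y,H}⁻¹ (F - K H)]`,
* `C = -E[(F - K H)ᵀ Σ_{U|Y,H}⁻¹ (I - K H)]`,
* `D = -1/2 E[log det (2π Σ_{U|Y,H})] - 1/2 E[tr (Kᵀ Σ_{U|Y,H}⁻¹ K Σ_Z)]`

exist and are finite. -/
structure FiniteExpectations (ν : Measure (Matrix (Fin N) (Fin M) ℝ))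
    (covZ : Matrix (Fin N) (Fin N) ℝ) : Prop where
  A : ∀ i j, Integrable (fun h => ((σ.residX covZ h)ᵀ * (σ.errCov covZ h)⁻¹ *
    σ.residX covZ h : Matrix (Fin M) (Fin M) ℝ) i j) ν
  B : ∀ i j, Integrable (fun h => ((σ.residS covZ h)ᵀ * (σ.errCov covZ h)⁻¹ *
    σ.residS covZ h : Matrix (Fin M) (Fin M) ℝ) i j) ν
  C : ∀ i j, Integrable (fun h => ((σ.residS covZ h)ᵀ * (σ.errCov covZ h)⁻¹ *
    σ.residX covZ h : Matrix (Fin M) (Fin M) ℝ) i j) ν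
  D_logdet : Integrable (fun h => Real.log ((2 * Real.pi) • σ.errCov covZ h).det) ν
  D_trace : Integrable (fun h => ((σ.gain covZ h)ᵀ * (σ.errCov covZ h)⁻¹ *
    σ.gain covZ h * covZ).trace) ν

end Setting

/-- A linear assignment with setting `σ` over the fading-paper channel `Y = H (X + S) + Z`
whose fading matrix has law `ν` and whose noise has covariance `covZ`: all the random
variables, on a common probability space. The signal `X` is an arbitrary zero-mean
random vector, possibly dependent on `S` and possibly non-Gaussian. -/
structure LinearAssignment {M N : ℕ} (σ : Setting M)
    (ν : Measure (Matrix (Fin N) (Fin M) ℝ)) (covZ : Matrix (Fin N) (Fin N) ℝ)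
    {Ω : Type*} [MeasurableSpace Ω] (P : Measure Ω) where
  /-- interference -/
  S : Ω → Fin M → ℝ
  /-- transmitted signal -/
  X : Ω → Fin M → ℝ
  /-- fading matrix -/
  H : Ω → Matrix (Fin N) (Fin M) ℝ
  /-- noise -/
  Z : Ω → Fin N → ℝ
  measurable_S : Measurable S
  measurable_X : Measurable X
  measurable_H : Measurable H
  measurable_Z : Measurable Z
  gaussian_S : HasGaussianLaw S P
  mean_S : ∀ i, ∫ ω, S ω i ∂P = 0
  cov_S : crossCov P S S = σ.covS
  memLp_X : ∀ i, MemLp (fun ω => X ω i) 2 P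
  mean_X : ∀ i, ∫ ω, X ω i ∂P = 0
  cov_X : crossCov P X X = σ.covX
  cov_SX : crossCov P S X = σ.covSX
  law_H : P.map H = ν
  gaussian_Z : HasGaussianLaw Z P
  mean_Z : ∀ i, ∫ ω, Z ω i ∂P = 0
  cov_Z : crossCov P Z Z = covZ
  /-- together with `indep_H_Z`: the pair `(S, X)`, `H` and `Z` are mutually independent -/
  indep_SX_HZ : IndepFun (fun ω => (S ω, X ω)) (fun ω => (H ω, Z ω)) P
  indep_H_Z : IndepFun H Z P

namespace LinearAssignment

variable {M N : ℕ} {σ : Setting M} {ν : Measure (Matrix (Fin N) (Fin M) ℝ)}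
  {covZ : Matrix (Fin N) (Fin N) ℝ} {Ω : Type*} [MeasurableSpace Ω] {P : Measure Ω}
  (a : LinearAssignment σ ν covZ P)

/-- The auxiliary variable `U = F S + X`. -/
def U (ω : Ω) : Fin M → ℝ := σ.F *ᵥ a.S ω + a.X ω

/-- The channel observation `Y = H (X + S) + Z`. -/
def Y (ω : Ω) : Fin N → ℝ := a.H ω *ᵥ (a.X ω + a.S ω) + a.Z ω

/-- `I(U; Y, H)`. -/
def infoOutput : ℝ≥0∞ := mutualInfo P a.U (fun ω => (a.Y ω, a.H ω))

/-- `I(U; S)`. -/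
def infoInterference : ℝ≥0∞ := mutualInfo P a.U a.S

/-- The rate `I(U; Y, H) - I(U; S)`, which may be `-∞`. -/
def rate : EReal := (a.infoOutput : EReal) - (a.infoInterference : EReal)

/-- `X` is jointly Gaussian with `S`. -/
def IsJointlyGaussian : Prop := HasGaussianLaw (fun ω => (a.S ω, a.X ω)) P

end LinearAssignment

/-- The linear-assignment capacity for a fixed setting: the supremum of the rates of all the
linear assignments with that setting for which a conditional density `q(u | s)` exists. -/
def linearAssignmentCapacity {M N : ℕ} (σ : Setting M)
    (ν : Measure (Matrix (Fin N) (Fin M) ℝ)) (covZ : Matrix (Fin N) (Fin N) ℝ) : EReal :=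
  sSup {r : EReal | ∃ (Ω : Type) (_ : MeasurableSpace Ω) (P : Measure Ω)
    (_ : IsProbabilityMeasure P) (a : LinearAssignment σ ν covZ P),
    HasCondDensity P a.U a.S ∧ a.rate = r}

end FadingPaper

end

/-! In terms of densities the marginal of `U` cancels from `I(U; Y, H) - I(U; S)`, and the rate
becomes the mean of `log Q(U | Y, H) - log q(U | S)`. Here `q` is the conditional density of `U`
given `S`, and `Q` is the posterior of `U` that `q` induces through the channel. Let `q'` and `Q'`
be the Gaussian conditional densities determined by the setting. For each value of `H`, `log Q'` and
`log q'` are quadratic in the other variables. The mean of `log Q' - log q'` therefore depends only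
on second moments, and it has the same value `gaussianRate` for every assignment with the setting
(`integral_logDensity_sub`).

It remains to compare the two means. Put `D = (log Q - log q) - (log Q' - log q')`. The law of `S`
and the kernel `k` from `(S, U)` to `(Y, H)` are common to all assignments, and Bayes' rule for the
Gaussian densities reads `∫ q' k dP_S = m' Q'` (`outputDensity_logDensityS_ae_eq`). Hence `E[exp D]
≤ ∫ (Q / Q') m' Q' = ∫ Q m' ≤ 1`, and `D ≤ exp D - 1` gives `E[D] ≤ 0`
(`integral_infoDensity_sub_le`). For a jointly Gaussian assignment `D = 0` almost surely
(`infoDensity_sub_ae_eq`), so the bound is attained.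

The subtraction needs finite terms. `I(U; Y, H)` is finite because the noise density is bounded and
`Y` is square integrable (`infoOutput_ne_top`). If `I(U; S)` is infinite, the rate is `-∞` and the
bound is trivial. Finally, a jointly Gaussian assignment is built by drawing `(S, U)` from its
prescribed covariance and setting `X = U - F S` (`exists_isJointlyGaussian`). -/

noncomputable section

namespace FadingPaper

/-! ### Laws given by densities, and their marginals. -/

section Density

variable {Ω α β : Type*} [MeasurableSpace Ω] [MeasurableSpace α] [MeasurableSpace β]
  {P : Measure Ω} {μ : Measure α} {ν : Measure β}

theorem map_eq_withDensity_of_lintegral {X : Ω → α} (hX : Measurable X) {f : α → ℝ≥0∞}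
    (hf : Measurable f)
    (h : ∀ g : α → ℝ≥0∞, Measurable g → ∫⁻ ω, g (X ω) ∂P = ∫⁻ x, f x * g x ∂μ) :
    P.map X = μ.withDensity f := by
  refine Measure.ext_of_lintegral _ fun g hg => ?_
  rw [lintegral_map hg hX, h g hg, lintegral_withDensity_eq_lintegral_mul _ hf hg]
  rfl

theorem lintegral_comp_eq_of_map_eq {X : Ω → α} (hX : Measurable X) {f : α → ℝ≥0∞}
    (hf : Measurable f) (h : P.map X = μ.withDensity f) {g : α → ℝ≥0∞} (hg : Measurable g) :
    ∫⁻ ω, g (X ω) ∂P = ∫⁻ x, f x * g x ∂μ := by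
  rw [← lintegral_map hg hX, h, lintegral_withDensity_eq_lintegral_mul _ hf hg]
  rfl

theorem lintegral_density_eq_one [IsProbabilityMeasure P] {X : Ω → α} (hX : Measurable X)
    {f : α → ℝ≥0∞} (hf : Measurable f) (h : P.map X = μ.withDensity f) :
    ∫⁻ x, f x ∂μ = 1 := by
  simpa using (lintegral_comp_eq_of_map_eq hX hf h (g := fun _ => 1) measurable_const).symm

theorem ae_density_ne_zero {X : Ω → α} (hX : Measurable X) {f : α → ℝ≥0∞} (hf : Measurable f)
    (h : P.map X = μ.withDensity f) : ∀ᵐ ω ∂P, f (X ω) ≠ 0 := by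
  refine ae_of_ae_map hX.aemeasurable (p := fun x => f x ≠ 0) ?_
  rw [h, ae_withDensity_iff hf]
  exact ae_of_all _ fun _ h => h

theorem ae_of_ae_base {X : Ω → α} (hX : Measurable X) {f : α → ℝ≥0∞}
    (h : P.map X = μ.withDensity f) {p : α → Prop} (hp : ∀ᵐ x ∂μ, p x) : ∀ᵐ ω ∂P, p (X ω) := by
  refine ae_of_ae_map hX.aemeasurable ?_
  rw [h]
  exact (withDensity_absolutelyContinuous _ _).ae_le hp

theorem ae_density_ne_top [IsProbabilityMeasure P] {X : Ω → α} (hX : Measurable X)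
    {f : α → ℝ≥0∞} (hf : Measurable f) (h : P.map X = μ.withDensity f) :
    ∀ᵐ ω ∂P, f (X ω) ≠ ∞ :=
  ae_of_ae_base hX h <| (ae_lt_top hf (by simp [lintegral_density_eq_one hX hf h])).mono
    fun _ h => h.ne

variable [SFinite ν] {V : Ω → α} {W : Ω → β} {j : α × β → ℝ≥0∞}

theorem map_fst_eq_withDensity (hV : Measurable V) (hW : Measurable W) (hj : Measurable j)
    (h : P.map (fun ω => (V ω, W ω)) = (μ.prod ν).withDensity j) :
    P.map V = μ.withDensity fun v => ∫⁻ w, j (v, w) ∂ν := by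
  refine map_eq_withDensity_of_lintegral hV hj.lintegral_prod_right' fun g hg => ?_
  rw [lintegral_comp_eq_of_map_eq (hV.prodMk hW) hj h (g := fun x => g x.1) (by fun_prop),
    lintegral_prod _ (by fun_prop)]
  refine lintegral_congr fun v => ?_
  exact lintegral_mul_const (g v) (f := fun w => j (v, w)) (by fun_prop)

variable [SFinite μ]

theorem map_swap_eq_withDensity (hV : Measurable V) (hW : Measurable W) (hj : Measurable j)
    (h : P.map (fun ω => (V ω, W ω)) = (μ.prod ν).withDensity j) :
    P.map (fun ω => (W ω, V ω)) = (ν.prod μ).withDensity fun x => j x.swap := by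
  refine map_eq_withDensity_of_lintegral (hW.prodMk hV) (by fun_prop) fun g hg => ?_
  have := lintegral_comp_eq_of_map_eq (hV.prodMk hW) hj h (g := fun x => g x.swap) (by fun_prop)
  rw [← lintegral_prod_swap] at this
  exact this

theorem map_snd_eq_withDensity (hV : Measurable V) (hW : Measurable W) (hj : Measurable j)
    (h : P.map (fun ω => (V ω, W ω)) = (μ.prod ν).withDensity j) :
    P.map W = ν.withDensity fun w => ∫⁻ v, j (v, w) ∂μ := by
  have hs : Measurable fun x : β × α => j x.swap := hj.comp measurable_swap
  have := map_fst_eq_withDensity (j := fun x => j x.swap) hW hV hs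
    (map_swap_eq_withDensity hV hW hj h)
  simpa only [Prod.swap_prod_mk] using this

end Density

/-! ### Mutual information as the mean of the information density. -/

section Information

variable {Ω α β : Type*} [MeasurableSpace Ω] [MeasurableSpace α] [MeasurableSpace β]
  {P : Measure Ω} {μ : Measure α} {ν : Measure β} {V : Ω → α} {W : Ω → β} {j : α × β → ℝ≥0∞}

/-- The information density of a pair of random variables whose joint law has density `j` with
respect to `μ.prod ν`. -/
def infoDensity (μ : Measure α) (ν : Measure β) (j : α × β → ℝ≥0∞) (x : α × β) : ℝ :=
  Real.log (j x).toReal - Real.log (∫⁻ w, j (x.1, w) ∂ν).toReal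
    - Real.log (∫⁻ v, j (v, x.2) ∂μ).toReal

variable [SigmaFinite μ] [SigmaFinite ν] [IsProbabilityMeasure P]

theorem measurable_infoDensity (hj : Measurable j) : Measurable (infoDensity μ ν j) := by
  have h1 : Measurable fun v => ∫⁻ w, j (v, w) ∂ν := hj.lintegral_prod_right'
  have h2 : Measurable fun w => ∫⁻ v, j (v, w) ∂μ := hj.lintegral_prod_left'
  unfold infoDensity
  fun_prop

/-- Almost surely, the joint density and the two marginal densities are positive and finite. -/
theorem ae_densities_pos (hV : Measurable V) (hW : Measurable W) (hj : Measurable j)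
    (h : P.map (fun ω => (V ω, W ω)) = (μ.prod ν).withDensity j) :
    ∀ᵐ ω ∂P, (j (V ω, W ω) ≠ 0 ∧ j (V ω, W ω) ≠ ∞) ∧
      ((∫⁻ w, j (V ω, w) ∂ν) ≠ 0 ∧ (∫⁻ w, j (V ω, w) ∂ν) ≠ ∞) ∧
      ((∫⁻ v, j (v, W ω) ∂μ) ≠ 0 ∧ (∫⁻ v, j (v, W ω) ∂μ) ≠ ∞) := by
  have hp : Measurable fun v => ∫⁻ w, j (v, w) ∂ν := hj.lintegral_prod_right'
  have hm : Measurable fun w => ∫⁻ v, j (v, w) ∂μ := hj.lintegral_prod_left'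
  have h1 := map_fst_eq_withDensity hV hW hj h
  have h2 := map_snd_eq_withDensity hV hW hj h
  filter_upwards [ae_density_ne_zero (hV.prodMk hW) hj h, ae_density_ne_top (hV.prodMk hW) hj h,
    ae_density_ne_zero hV hp h1, ae_density_ne_top hV hp h1, ae_density_ne_zero hW hm h2,
    ae_density_ne_top hW hm h2] with ω a b c d e f
  exact ⟨⟨a, b⟩, ⟨c, d⟩, ⟨e, f⟩⟩

theorem exp_log_toReal {x : ℝ≥0∞} (h0 : x ≠ 0) (h1 : x ≠ ∞) :
    ENNReal.ofReal (Real.exp (Real.log x.toReal)) = x := by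
  rw [Real.exp_log (ENNReal.toReal_pos h0 h1), ENNReal.ofReal_toReal h1]

theorem joint_eq_withDensity_marginals (hV : Measurable V) (hW : Measurable W)
    (hj : Measurable j) (h : P.map (fun ω => (V ω, W ω)) = (μ.prod ν).withDensity j) :
    P.map (fun ω => (V ω, W ω)) = ((P.map V).prod (P.map W)).withDensity fun x =>
      j x / ((∫⁻ w, j (x.1, w) ∂ν) * ∫⁻ v, j (v, x.2) ∂μ) := by
  have hp : Measurable fun v => ∫⁻ w, j (v, w) ∂ν := hj.lintegral_prod_right'
  have hm : Measurable fun w => ∫⁻ v, j (v, w) ∂μ := hj.lintegral_prod_left'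
  rw [map_fst_eq_withDensity hV hW hj h, map_snd_eq_withDensity hV hW hj h,
    prod_withDensity hp hm, ← withDensity_mul _ (by fun_prop) (by fun_prop), h]
  refine withDensity_congr_ae ?_
  have hpos : ∀ᵐ x ∂(μ.prod ν).withDensity j, ((∫⁻ w, j (x.1, w) ∂ν) ≠ 0 ∧
      (∫⁻ w, j (x.1, w) ∂ν) ≠ ∞) ∧ ((∫⁻ v, j (v, x.2) ∂μ) ≠ 0 ∧ (∫⁻ v, j (v, x.2) ∂μ) ≠ ∞) := by
    rw [← h, ae_map_iff (hV.prodMk hW).aemeasurable]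
    · exact (ae_densities_pos hV hW hj h).mono fun ω h => h.2
    · have hp' : Measurable fun x : α × β => ∫⁻ w, j (x.1, w) ∂ν := by fun_prop
      have hm' : Measurable fun x : α × β => ∫⁻ v, j (v, x.2) ∂μ := by fun_prop
      refine ((hp' (measurableSet_singleton 0).compl).inter
        (hp' (measurableSet_singleton ∞).compl)).inter
        ((hm' (measurableSet_singleton 0).compl).inter (hm' (measurableSet_singleton ∞).compl))
  rw [ae_withDensity_iff hj] at hpos
  filter_upwards [hpos] with x hx
  -- Where `j` vanishes both sides are `0`, so the marginals need to be positive and finite only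
  -- where `j` does not vanish, that is, almost everywhere for the joint law.
  by_cases h0 : j x = 0
  · simp [h0]
  · obtain ⟨⟨a, b⟩, c, d⟩ := hx h0
    simp only [Pi.mul_apply]
    rw [ENNReal.mul_div_cancel (mul_ne_zero a c) (ENNReal.mul_ne_top b d)]

theorem llr_comp_ae_eq_infoDensity (hV : Measurable V) (hW : Measurable W) (hj : Measurable j)
    (h : P.map (fun ω => (V ω, W ω)) = (μ.prod ν).withDensity j) :
    llr (P.map fun ω => (V ω, W ω)) ((P.map V).prod (P.map W))
      =ᵐ[P.map fun ω => (V ω, W ω)] infoDensity μ ν j := by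
  have := Measure.isProbabilityMeasure_map (μ := P) hV.aemeasurable
  have := Measure.isProbabilityMeasure_map (μ := P) hW.aemeasurable
  have hp : Measurable fun v => ∫⁻ w, j (v, w) ∂ν := hj.lintegral_prod_right'
  have hm : Measurable fun w => ∫⁻ v, j (v, w) ∂μ := hj.lintegral_prod_left'
  have key := joint_eq_withDensity_marginals hV hW hj h
  have hac : P.map (fun ω => (V ω, W ω)) ≪ (P.map V).prod (P.map W) := by
    rw [key]; exact withDensity_absolutelyContinuous _ _
  have hrn := Measure.rnDeriv_withDensity ((P.map V).prod (P.map W))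
    (f := fun x => j x / ((∫⁻ w, j (x.1, w) ∂ν) * ∫⁻ v, j (v, x.2) ∂μ)) (by fun_prop)
  rw [← key] at hrn
  have hll : Measurable (llr (P.map fun ω => (V ω, W ω)) ((P.map V).prod (P.map W))) :=
    measurable_llr _ _
  rw [Filter.EventuallyEq, ae_map_iff (hV.prodMk hW).aemeasurable
    (measurableSet_eq_fun hll (measurable_infoDensity hj))]
  filter_upwards [ae_of_ae_map (hV.prodMk hW).aemeasurable (hac.ae_le hrn),
    ae_densities_pos hV hW hj h] with ω h1 ⟨⟨a, b⟩, ⟨c, d⟩, ⟨e, f⟩⟩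
  simp only [llr_def]
  rw [h1, infoDensity, ENNReal.toReal_div, ENNReal.toReal_mul,
    Real.log_div (ENNReal.toReal_pos a b).ne'
      (mul_pos (ENNReal.toReal_pos c d) (ENNReal.toReal_pos e f)).ne',
    Real.log_mul (ENNReal.toReal_pos c d).ne' (ENNReal.toReal_pos e f).ne']
  ring

theorem joint_absolutelyContinuous (hV : Measurable V) (hW : Measurable W)
    (hj : Measurable j) (h : P.map (fun ω => (V ω, W ω)) = (μ.prod ν).withDensity j) :
    P.map (fun ω => (V ω, W ω)) ≪ (P.map V).prod (P.map W) := by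
  rw [joint_eq_withDensity_marginals hV hW hj h]
  exact withDensity_absolutelyContinuous _ _

theorem mutualInfo_ne_top_iff (hV : Measurable V) (hW : Measurable W) (hj : Measurable j)
    (h : P.map (fun ω => (V ω, W ω)) = (μ.prod ν).withDensity j) :
    mutualInfo P V W ≠ ∞ ↔ Integrable (fun ω => infoDensity μ ν j (V ω, W ω)) P := by
  rw [mutualInfo, InformationTheory.klDiv_ne_top_iff,
    integrable_congr (llr_comp_ae_eq_infoDensity hV hW hj h),
    integrable_map_measure (measurable_infoDensity hj).aestronglyMeasurable
      (hV.prodMk hW).aemeasurable]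
  exact and_iff_right (joint_absolutelyContinuous hV hW hj h)

theorem toReal_mutualInfo (hV : Measurable V) (hW : Measurable W) (hj : Measurable j)
    (h : P.map (fun ω => (V ω, W ω)) = (μ.prod ν).withDensity j) :
    (mutualInfo P V W).toReal = ∫ ω, infoDensity μ ν j (V ω, W ω) ∂P := by
  have := Measure.isProbabilityMeasure_map (μ := P) hV.aemeasurable
  have := Measure.isProbabilityMeasure_map (μ := P) hW.aemeasurable
  have := Measure.isProbabilityMeasure_map (μ := P) (hV.prodMk hW).aemeasurable
  rw [mutualInfo, InformationTheory.toReal_klDiv_of_measure_eq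
    (joint_absolutelyContinuous hV hW hj h) (by simp),
    integral_congr_ae (llr_comp_ae_eq_infoDensity hV hW hj h),
    integral_map (hV.prodMk hW).aemeasurable (measurable_infoDensity hj).aestronglyMeasurable]

end Information

/-! ### A domination criterion for finite mutual information. -/

section Information

variable {Ω α β : Type*} [MeasurableSpace Ω] [MeasurableSpace α] [MeasurableSpace β]
  {P : Measure Ω} {μ : Measure α} {ν : Measure β} {V : Ω → α} {W : Ω → β} {j : α × β → ℝ≥0∞}

/-- Only an inequality: the part of `g` carried by the zero set of `f` is lost. -/
theorem lintegral_div_density_le {X : Ω → α} (hX : Measurable X) {f g : α → ℝ≥0∞}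
    (hf : Measurable f) (hg : Measurable g) (h : P.map X = μ.withDensity f) :
    ∫⁻ ω, g (X ω) / f (X ω) ∂P ≤ ∫⁻ x, g x ∂μ := by
  rw [lintegral_comp_eq_of_map_eq hX hf h (g := fun x => g x / f x) (by fun_prop)]
  exact lintegral_mono fun x => ENNReal.mul_div_le

theorem integrable_of_lintegral_ofReal_ne_top {f : Ω → ℝ} (hf : Measurable f)
    (h : ∫⁻ ω, ENNReal.ofReal (f ω) ∂P ≠ ∞) (h0 : ∀ ω, 0 ≤ f ω) : Integrable f P := by
  rw [← lintegral_ofReal_ne_top_iff_integrable hf.aestronglyMeasurable (ae_of_all _ h0)]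
  exact h

theorem ofReal_exp_neg_infoDensity {v : α} {w : β} (h1 : j (v, w) ≠ 0 ∧ j (v, w) ≠ ∞)
    (h2 : (∫⁻ w, j (v, w) ∂ν) ≠ 0 ∧ (∫⁻ w, j (v, w) ∂ν) ≠ ∞)
    (h3 : (∫⁻ v, j (v, w) ∂μ) ≠ 0 ∧ (∫⁻ v, j (v, w) ∂μ) ≠ ∞) :
    ENNReal.ofReal (Real.exp (-infoDensity μ ν j (v, w))) =
      (∫⁻ w, j (v, w) ∂ν) * (∫⁻ v, j (v, w) ∂μ) / j (v, w) := by
  rw [infoDensity, show ∀ a b c : ℝ, -(a - b - c) = b + c - a by intros; ring, Real.exp_sub,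
    ENNReal.ofReal_div_of_pos (Real.exp_pos _), Real.exp_add,
    ENNReal.ofReal_mul (Real.exp_pos _).le, exp_log_toReal h1.1 h1.2, exp_log_toReal h2.1 h2.2,
    exp_log_toReal h3.1 h3.2]

variable [SigmaFinite μ] [SigmaFinite ν] [IsProbabilityMeasure P]

theorem lintegral_exp_neg_infoDensity_le (hV : Measurable V) (hW : Measurable W)
    (hj : Measurable j) (h : P.map (fun ω => (V ω, W ω)) = (μ.prod ν).withDensity j) :
    ∫⁻ ω, ENNReal.ofReal (Real.exp (-infoDensity μ ν j (V ω, W ω))) ∂P ≤ 1 := by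
  have hp : Measurable fun v => ∫⁻ w, j (v, w) ∂ν := hj.lintegral_prod_right'
  have hm : Measurable fun w => ∫⁻ v, j (v, w) ∂μ := hj.lintegral_prod_left'
  calc
    _ = ∫⁻ ω, (fun x : α × β => (∫⁻ w, j (x.1, w) ∂ν) * (∫⁻ v, j (v, x.2) ∂μ)) (V ω, W ω)
          / j (V ω, W ω) ∂P := by
      refine lintegral_congr_ae ?_
      filter_upwards [ae_densities_pos hV hW hj h] with ω hω
      exact ofReal_exp_neg_infoDensity hω.1 hω.2.1 hω.2.2
    _ ≤ ∫⁻ x, (∫⁻ w, j (x.1, w) ∂ν) * (∫⁻ v, j (v, x.2) ∂μ) ∂μ.prod ν :=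
      lintegral_div_density_le (hV.prodMk hW) hj (by fun_prop) h
    _ = 1 := by
      rw [lintegral_prod_mul hp.aemeasurable hm.aemeasurable,
        lintegral_density_eq_one hV hp (map_fst_eq_withDensity hV hW hj h),
        lintegral_density_eq_one hW hm (map_snd_eq_withDensity hV hW hj h), one_mul]

/-- Let `ℓ = log j - log p - log m` be the information density, with `p` and `m` the marginal
densities. From below, `-ℓ ≤ exp (-ℓ)`, whose mean is at most `1`. From above, the hypothesis gives
`ℓ ≤ b + log (r₁ / p) + log (r₂ / m) ≤ b + r₁ / p + r₂ / m`, and the two ratios have means at most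
`∫ r₁` and `∫ r₂`. Thus `ℓ` is integrable. -/
theorem mutualInfo_ne_top_of_le (hV : Measurable V) (hW : Measurable W)
    (hj : Measurable j) (h : P.map (fun ω => (V ω, W ω)) = (μ.prod ν).withDensity j)
    {r₁ : α → ℝ≥0∞} {r₂ : β → ℝ≥0∞} (hr₁ : Measurable r₁) (hr₂ : Measurable r₂)
    (hr₁' : ∫⁻ v, r₁ v ∂μ ≠ ∞) (hr₂' : ∫⁻ w, r₂ w ∂ν ≠ ∞)
    {b : Ω → ℝ} (hb : Integrable b P)
    (hle : ∀ᵐ ω ∂P, j (V ω, W ω) ≤ ENNReal.ofReal (Real.exp (b ω)) * r₁ (V ω) * r₂ (W ω)) :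
    mutualInfo P V W ≠ ∞ := by
  have hp : Measurable fun v => ∫⁻ w, j (v, w) ∂ν := hj.lintegral_prod_right'
  have hm : Measurable fun w => ∫⁻ v, j (v, w) ∂μ := hj.lintegral_prod_left'
  have h1 := map_fst_eq_withDensity hV hW hj h
  have h2 := map_snd_eq_withDensity hV hW hj h
  rw [mutualInfo_ne_top_iff hV hW hj h]
  have hℓ : Measurable fun ω => infoDensity μ ν j (V ω, W ω) :=
    (measurable_infoDensity hj).comp (hV.prodMk hW)
  have e1 : Integrable (fun ω => Real.exp (-infoDensity μ ν j (V ω, W ω))) P := by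
    refine integrable_of_lintegral_ofReal_ne_top (by fun_prop) ?_ fun _ => (Real.exp_pos _).le
    exact ((lintegral_exp_neg_infoDensity_le hV hW hj h).trans_lt ENNReal.one_lt_top).ne
  have l2 := (lintegral_div_density_le hV hp hr₁ h1).trans_lt hr₁'.lt_top
  have l3 := (lintegral_div_density_le hW hm hr₂ h2).trans_lt hr₂'.lt_top
  have m2 : Measurable fun ω => r₁ (V ω) / ∫⁻ w, j (V ω, w) ∂ν :=
    (hr₁.div hp).comp hV
  have m3 : Measurable fun ω => r₂ (W ω) / ∫⁻ v, j (v, W ω) ∂μ :=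
    (hr₂.div hm).comp hW
  have e2 := integrable_toReal_of_lintegral_ne_top m2.aemeasurable l2.ne
  have e3 := integrable_toReal_of_lintegral_ne_top m3.aemeasurable l3.ne
  refine (((e1.add hb.abs).add e2).add e3).mono' hℓ.aestronglyMeasurable ?_
  filter_upwards [hle, ae_densities_pos hV hW hj h, ae_lt_top m2 l2.ne, ae_lt_top m3 l3.ne]
    with ω hle ⟨⟨a, a'⟩, ⟨c, d⟩, ⟨e, f⟩⟩ t2 t3
  simp only [Pi.add_apply]
  rw [Real.norm_eq_abs, abs_le']
  have n1 := Real.add_one_le_exp (-infoDensity μ ν j (V ω, W ω))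
  have n2 : 0 ≤ (r₁ (V ω) / ∫⁻ w, j (V ω, w) ∂ν).toReal := ENNReal.toReal_nonneg
  have n3 : 0 ≤ (r₂ (W ω) / ∫⁻ v, j (v, W ω) ∂μ).toReal := ENNReal.toReal_nonneg
  refine ⟨?_, by linarith [abs_nonneg (b ω)]⟩
  have hr1 : r₁ (V ω) ≠ 0 := by
    intro h0; simp only [h0, mul_zero, zero_mul, nonpos_iff_eq_zero] at hle; exact a hle
  have hr2 : r₂ (W ω) ≠ 0 := by
    intro h0; simp only [h0, mul_zero, nonpos_iff_eq_zero] at hle; exact a hle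
  -- The ratio `r₁ / p` is almost surely finite and so is `p`, hence `r₁` is finite at the sampled
  -- point; the same argument applies to `r₂`.
  have hr1t : r₁ (V ω) ≠ ∞ := by
    intro h0
    rw [h0, ENNReal.top_div_of_ne_top d] at t2
    exact absurd t2 (lt_irrefl _)
  have hr2t : r₂ (W ω) ≠ ∞ := by
    intro h0
    rw [h0, ENNReal.top_div_of_ne_top f] at t3
    exact absurd t3 (lt_irrefl _)
  have hlog : Real.log (j (V ω, W ω)).toReal ≤
      b ω + Real.log (r₁ (V ω)).toReal + Real.log (r₂ (W ω)).toReal := by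
    have := ENNReal.toReal_mono (ENNReal.mul_ne_top (ENNReal.mul_ne_top ENNReal.ofReal_ne_top
      hr1t) hr2t) hle
    rw [ENNReal.toReal_mul, ENNReal.toReal_mul, ENNReal.toReal_ofReal (Real.exp_pos _).le] at this
    have p1 := ENNReal.toReal_pos hr1 hr1t
    have p2 := ENNReal.toReal_pos hr2 hr2t
    have := Real.log_le_log (ENNReal.toReal_pos a a') this
    rwa [Real.log_mul (by positivity) p2.ne', Real.log_mul (by positivity) p1.ne',
      Real.log_exp] at this
  have k2 := Real.log_le_sub_one_of_pos (ENNReal.toReal_pos (ENNReal.div_pos hr1 d).ne' t2.ne)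
  have k3 := Real.log_le_sub_one_of_pos (ENNReal.toReal_pos (ENNReal.div_pos hr2 f).ne' t3.ne)
  rw [ENNReal.toReal_div, Real.log_div (ENNReal.toReal_pos hr1 hr1t).ne'
    (ENNReal.toReal_pos c d).ne', ← ENNReal.toReal_div] at k2
  rw [ENNReal.toReal_div, Real.log_div (ENNReal.toReal_pos hr2 hr2t).ne'
    (ENNReal.toReal_pos e f).ne', ← ENNReal.toReal_div] at k3
  have := Real.exp_pos (-infoDensity μ ν j (V ω, W ω))
  have := le_abs_self (b ω)
  rw [infoDensity] at *
  linarith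

end Information

/-! ### Gibbs' inequality for the difference of two informations. -/

section Comparison

variable {Ω 𝓢 𝓤 𝓦 : Type*} [MeasurableSpace Ω] [MeasurableSpace 𝓢] [MeasurableSpace 𝓤]
  [MeasurableSpace 𝓦] {P : Measure Ω} {π : Measure 𝓢} {α : Measure 𝓤} {β : Measure 𝓦}
  [SigmaFinite π] [SigmaFinite α] [SigmaFinite β]
  {S : Ω → 𝓢} {U : Ω → 𝓤} {W : Ω → 𝓦} {q : 𝓢 × 𝓤 → ℝ≥0∞} {k : 𝓢 × 𝓤 × 𝓦 → ℝ≥0∞}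

/-- The joint density of `(U, W)` when `(S, U, W)` has density `q (s, u) * k (s, u, w)`. -/
def outputDensity (π : Measure 𝓢) (q : 𝓢 × 𝓤 → ℝ≥0∞) (k : 𝓢 × 𝓤 × 𝓦 → ℝ≥0∞) (x : 𝓤 × 𝓦) :
    ℝ≥0∞ :=
  ∫⁻ s, q (s, x.1) * k (s, x) ∂π

theorem measurable_outputDensity (hq : Measurable q) (hk : Measurable k) :
    Measurable (outputDensity π q k) :=
  Measurable.lintegral_prod_left' (f := fun x : 𝓢 × 𝓤 × 𝓦 => q (x.1, x.2.1) * k (x.1, x.2))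
    (by fun_prop)

theorem map_output_eq_withDensity (hS : Measurable S) (hU : Measurable U) (hW : Measurable W)
    (hq : Measurable q) (hk : Measurable k)
    (h : P.map (fun ω => (S ω, U ω, W ω)) =
      (π.prod (α.prod β)).withDensity fun x => q (x.1, x.2.1) * k x) :
    P.map (fun ω => (U ω, W ω)) = (α.prod β).withDensity (outputDensity π q k) :=
  map_snd_eq_withDensity (j := fun x => q (x.1, x.2.1) * k x) (W := fun ω => (U ω, W ω)) hS
    (hU.prodMk hW) (by fun_prop) h

variable [IsProbabilityMeasure P]

/-- Gibbs' inequality for the difference of two information densities: `q'` and `Q'` are the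
candidate conditional densities of `U` given `S` and of `U` given `W`. -/
theorem integral_infoDensity_sub_le (hS : Measurable S) (hU : Measurable U) (hW : Measurable W)
    (hq : Measurable q) (hk : Measurable k)
    (h : P.map (fun ω => (S ω, U ω, W ω)) =
      (π.prod (α.prod β)).withDensity fun x => q (x.1, x.2.1) * k x)
    (hSU : P.map (fun ω => (S ω, U ω)) = (π.prod α).withDensity q)
    (hq1 : ∀ s, ∫⁻ u, q (s, u) ∂α = 1)
    {q' : 𝓢 × 𝓤 → ℝ} {Q' : 𝓤 × 𝓦 → ℝ} {m' : 𝓦 → ℝ≥0∞} (hq' : Measurable q')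
    (hQ' : Measurable Q') (hm' : Measurable m') (hm1 : ∫⁻ w, m' w ∂β ≤ 1)
    (hQm : outputDensity π (fun x => ENNReal.ofReal (Real.exp (q' x))) k =ᵐ[α.prod β]
      fun x => m' x.2 * ENNReal.ofReal (Real.exp (Q' x)))
    (h1 : Integrable (fun ω => infoDensity α β (outputDensity π q k) (U ω, W ω)) P)
    (h2 : Integrable (fun ω => infoDensity α π (fun x => q x.swap) (U ω, S ω)) P)
    (hL : Integrable (fun ω => Q' (U ω, W ω) - q' (S ω, U ω)) P) :
    ∫ ω, infoDensity α β (outputDensity π q k) (U ω, W ω) ∂P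
        - ∫ ω, infoDensity α π (fun x => q x.swap) (U ω, S ω) ∂P
      ≤ ∫ ω, (Q' (U ω, W ω) - q' (S ω, U ω)) ∂P := by
  set j := outputDensity π q k with hjdef
  have hj : Measurable j := measurable_outputDensity hq hk
  have hUW := map_output_eq_withDensity hS hU hW hq hk h
  have hUS := map_swap_eq_withDensity hS hU hq hSU
  have hqs : Measurable fun x : 𝓤 × 𝓢 => q x.swap := by fun_prop
  have hp : Measurable fun u => ∫⁻ w, j (u, w) ∂β := hj.lintegral_prod_right'
  have hp2 : Measurable fun u => ∫⁻ s, q (s, u) ∂π := hq.lintegral_prod_left'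
  have hm : Measurable fun w => ∫⁻ u, j (u, w) ∂α := hj.lintegral_prod_left'
  -- The density of `U` computed from `(U, W)` agrees with the one computed from `(S, U)`. These two
  -- terms cancel in the difference of the information densities.
  have hpeq : ∀ᵐ ω ∂P, (∫⁻ w, j (U ω, w) ∂β) = ∫⁻ s, q (s, U ω) ∂π := by
    have e1 := map_fst_eq_withDensity hU hW hj hUW
    have e2 := map_snd_eq_withDensity hS hU hq hSU
    refine ae_of_ae_base hU e1 (p := fun u => (∫⁻ w, j (u, w) ∂β) = ∫⁻ s, q (s, u) ∂π) ?_
    exact (withDensity_eq_iff hp.aemeasurable hp2.aemeasurable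
      (by simp [lintegral_density_eq_one hU hp e1])).1 (e1.symm.trans e2)
  set D : Ω → ℝ := fun ω => infoDensity α β j (U ω, W ω)
    - infoDensity α π (fun x => q x.swap) (U ω, S ω) - (Q' (U ω, W ω) - q' (S ω, U ω)) with hD
  have hDm : Measurable D := by
    have m1 := (measurable_infoDensity (μ := α) (ν := β) hj).comp (hU.prodMk hW)
    have m2 := (measurable_infoDensity (μ := α) (ν := π) hqs).comp (hU.prodMk hS)
    exact (m1.sub m2).sub ((hQ'.comp (hU.prodMk hW)).sub (hq'.comp (hS.prodMk hU)))
  have hexp : ∀ᵐ ω ∂P, ENNReal.ofReal (Real.exp (D ω)) =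
      j (U ω, W ω) / (∫⁻ u, j (u, W ω) ∂α) / ENNReal.ofReal (Real.exp (Q' (U ω, W ω)))
        * ENNReal.ofReal (Real.exp (q' (S ω, U ω))) / q (S ω, U ω) := by
    filter_upwards [ae_densities_pos hU hW hj hUW, ae_densities_pos hU hS hqs hUS, hpeq]
      with ω ⟨a, b, c⟩ ⟨d, e, f⟩ hpe
    have hDω : D ω = Real.log (j (U ω, W ω)).toReal - Real.log (∫⁻ u, j (u, W ω) ∂α).toReal
        - Q' (U ω, W ω) + q' (S ω, U ω) - Real.log (q (S ω, U ω)).toReal := by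
      -- By `hq1` the density of `S` relative to `π` is `1`, so its logarithm drops out.
      simp only [hD, infoDensity, hpe, Prod.swap_prod_mk, hq1, ENNReal.toReal_one, Real.log_one]
      ring
    simp only [Prod.swap_prod_mk] at d
    rw [hDω, Real.exp_sub, ENNReal.ofReal_div_of_pos (Real.exp_pos _), Real.exp_add,
      ENNReal.ofReal_mul (Real.exp_pos _).le, Real.exp_sub,
      ENNReal.ofReal_div_of_pos (Real.exp_pos _), Real.exp_sub,
      ENNReal.ofReal_div_of_pos (Real.exp_pos _), exp_log_toReal a.1 a.2, exp_log_toReal c.1 c.2,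
      exp_log_toReal d.1 d.2]
  have hle : ∫⁻ ω, ENNReal.ofReal (Real.exp (D ω)) ∂P ≤ 1 := by
    rw [lintegral_congr_ae hexp]
    rw [lintegral_comp_eq_of_map_eq (hS.prodMk (hU.prodMk hW)) (by fun_prop) h
      (g := fun x => j x.2 / (∫⁻ u, j (u, x.2.2) ∂α) / ENNReal.ofReal (Real.exp (Q' x.2))
        * ENNReal.ofReal (Real.exp (q' (x.1, x.2.1))) / q (x.1, x.2.1)) (by fun_prop)]
    calc
      _ ≤ ∫⁻ x, j x.2 / (∫⁻ u, j (u, x.2.2) ∂α) / ENNReal.ofReal (Real.exp (Q' x.2))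
          * (ENNReal.ofReal (Real.exp (q' (x.1, x.2.1))) * k x) ∂π.prod (α.prod β) := by
        -- The weight `q` of the law cancels the `q` in the denominator of `exp D`. The outcome is
        -- an inequality because `q` may vanish where `exp q'` does not.
        refine lintegral_mono fun x => ?_
        rw [show ∀ a b c d : ℝ≥0∞, a * b * (c * d / a) = c * (d * b) * (a / a) by
          intros; simp only [div_eq_mul_inv]; ring]
        exact mul_le_of_le_one_right' ENNReal.div_self_le_one
      _ = ∫⁻ x, j x / (∫⁻ u, j (u, x.2) ∂α) / ENNReal.ofReal (Real.exp (Q' x))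
          * outputDensity π (fun x => ENNReal.ofReal (Real.exp (q' x))) k x ∂α.prod β := by
        -- Only the last factor depends on `s`. Integrating it produces the output density for `q'`,
        -- to which `hQm` then applies.
        rw [lintegral_prod_symm' _ (by fun_prop)]
        refine lintegral_congr fun x => ?_
        exact lintegral_const_mul
          (j x / (∫⁻ u, j (u, x.2) ∂α) / ENNReal.ofReal (Real.exp (Q' x)))
          (f := fun s => ENNReal.ofReal (Real.exp (q' (s, x.1))) * k (s, x)) (by fun_prop)
      _ = ∫⁻ x, j x / (∫⁻ u, j (u, x.2) ∂α) / ENNReal.ofReal (Real.exp (Q' x))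
          * (m' x.2 * ENNReal.ofReal (Real.exp (Q' x))) ∂α.prod β := by
        refine lintegral_congr_ae ?_
        filter_upwards [hQm] with x hx
        rw [hx]
      _ = ∫⁻ x, j x / (∫⁻ u, j (u, x.2) ∂α) * m' x.2 ∂α.prod β := by
        refine lintegral_congr fun x => ?_
        rw [mul_comm (m' _), ← mul_assoc, ENNReal.div_mul_cancel
          (by simpa using Real.exp_pos _) ENNReal.ofReal_ne_top]
      -- For fixed `w` the true posterior `j / ∫ j` has total mass at most `1`, which leaves the
      -- mass of `m'`.
      _ = ∫⁻ w, (∫⁻ u, j (u, w) ∂α) / (∫⁻ u, j (u, w) ∂α) * m' w ∂β := by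
        rw [lintegral_prod_symm' _ (by fun_prop)]
        refine lintegral_congr fun w => ?_
        simp only [div_eq_mul_inv]
        rw [lintegral_mul_const _ (by fun_prop), lintegral_mul_const _ (by fun_prop)]
      _ ≤ ∫⁻ w, 1 * m' w ∂β := lintegral_mono fun w => by gcongr; exact ENNReal.div_self_le_one
      _ ≤ 1 := by simpa using hm1
  have hDi : Integrable D P := (h1.sub h2).sub hL
  have hEi : Integrable (fun ω => Real.exp (D ω)) P :=
    integrable_of_lintegral_ofReal_ne_top (by fun_prop) (hle.trans_lt ENNReal.one_lt_top).ne
      fun _ => (Real.exp_pos _).le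
  have hE1 : ∫ ω, Real.exp (D ω) ∂P ≤ 1 := by
    rw [integral_eq_lintegral_of_nonneg_ae (ae_of_all _ fun _ => (Real.exp_pos _).le)
      hEi.aestronglyMeasurable]
    exact ENNReal.toReal_le_of_le_ofReal zero_le_one (by simpa using hle)
  have hD0 : ∫ ω, D ω ∂P ≤ 0 := by
    calc ∫ ω, D ω ∂P ≤ ∫ ω, (Real.exp (D ω) - 1) ∂P :=
          integral_mono hDi (hEi.sub (integrable_const _))
            fun ω => by linarith [Real.add_one_le_exp (D ω)]
      _ = ∫ ω, Real.exp (D ω) ∂P - 1 := by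
          rw [integral_sub hEi (integrable_const _)]; simp
      _ ≤ 0 := by linarith
  have : ∫ ω, D ω ∂P = ∫ ω, infoDensity α β j (U ω, W ω) ∂P
      - ∫ ω, infoDensity α π (fun x => q x.swap) (U ω, S ω) ∂P
      - ∫ ω, (Q' (U ω, W ω) - q' (S ω, U ω)) ∂P := by
    rw [← integral_sub h1 h2]
    exact integral_sub (h1.sub h2) hL
  linarith

/-- The equality case of `integral_infoDensity_sub_le`. -/
theorem infoDensity_sub_ae_eq (hS : Measurable S) (hU : Measurable U) (hW : Measurable W)
    (hq : Measurable q) (hk : Measurable k) {q' : 𝓢 × 𝓤 → ℝ} {Q' : 𝓤 × 𝓦 → ℝ} {m' : 𝓦 → ℝ≥0∞}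
    (hqq : ∀ x, q x = ENNReal.ofReal (Real.exp (q' x))) (hQ' : Measurable Q') (hm' : Measurable m')
    (h : P.map (fun ω => (S ω, U ω, W ω)) = (π.prod (α.prod β)).withDensity
      fun x => q (x.1, x.2.1) * k x)
    (hSU : P.map (fun ω => (S ω, U ω)) =
      (π.prod α).withDensity q)
    (hq1 : ∀ s, ∫⁻ u, q (s, u) ∂α = 1)
    (hQ1 : ∀ w, ∫⁻ u, ENNReal.ofReal (Real.exp (Q' (u, w))) ∂α = 1)
    (hQm : outputDensity π q k =ᵐ[α.prod β]
      fun x => m' x.2 * ENNReal.ofReal (Real.exp (Q' x))) :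
    (fun ω => infoDensity α β (outputDensity π q k) (U ω, W ω)
        - infoDensity α π (fun x => q x.swap) (U ω, S ω))
      =ᵐ[P] fun ω => Q' (U ω, W ω) - q' (S ω, U ω) := by
  set j := outputDensity π q k with hjdef
  have hj : Measurable j := measurable_outputDensity hq hk
  have hUW := map_output_eq_withDensity hS hU hW hq hk h
  have hp : Measurable fun u => ∫⁻ w, j (u, w) ∂β := hj.lintegral_prod_right'
  have hp2 : Measurable fun u => ∫⁻ s, q (s, u) ∂π := hq.lintegral_prod_left'
  have hm : Measurable fun w => ∫⁻ u, j (u, w) ∂α := hj.lintegral_prod_left'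
  have hpeq : ∀ᵐ ω ∂P, (∫⁻ w, j (U ω, w) ∂β) = ∫⁻ s, q (s, U ω) ∂π := by
    have e1 := map_fst_eq_withDensity hU hW hj hUW
    have e2 := map_snd_eq_withDensity hS hU hq hSU
    refine ae_of_ae_base hU e1 (p := fun u => (∫⁻ w, j (u, w) ∂β) = ∫⁻ s, q (s, u) ∂π) ?_
    exact (withDensity_eq_iff hp.aemeasurable hp2.aemeasurable
      (by simp [lintegral_density_eq_one hU hp e1])).1 (e1.symm.trans e2)
  -- Since `Q'` is normalised in `u`, the factor `m'` must be the density of `W`; hence `exp Q'` is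
  -- the true posterior.
  have hmeq : ∀ᵐ ω ∂P, (∫⁻ u, j (u, W ω) ∂α) = m' (W ω) := by
    have e1 := map_snd_eq_withDensity hU hW hj hUW
    have hUW' : P.map (fun ω => (U ω, W ω)) =
        (α.prod β).withDensity fun x => m' x.2 * ENNReal.ofReal (Real.exp (Q' x)) :=
      hUW.trans (withDensity_congr_ae hQm)
    have e2 := map_snd_eq_withDensity hU hW (by fun_prop) hUW'
    refine ae_of_ae_base hW e1 (p := fun w => (∫⁻ u, j (u, w) ∂α) = m' w) ?_
    refine (withDensity_eq_iff hm.aemeasurable hm'.aemeasurable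
      (by simp [lintegral_density_eq_one hW hm e1])).1 (e1.symm.trans (e2.trans ?_))
    congr 1
    ext w
    have := lintegral_const_mul (μ := α) (m' w)
      (f := fun u => ENNReal.ofReal (Real.exp (Q' (u, w)))) (by fun_prop)
    rw [hQ1, mul_one] at this
    exact this
  filter_upwards [hpeq, hmeq, ae_of_ae_base (hU.prodMk hW) hUW hQm,
    ae_densities_pos hU hW hj hUW] with ω e1 e2 e3 ⟨_, _, hm0, hmt⟩
  rw [e2] at hm0 hmt
  simp only [infoDensity, e1, e2, e3, Prod.swap_prod_mk, hq1, hqq (S ω, U ω)]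
  rw [
    ENNReal.toReal_mul, ENNReal.toReal_ofReal (Real.exp_pos _).le,
    ENNReal.toReal_ofReal (Real.exp_pos _).le,
    Real.log_mul (ENNReal.toReal_pos hm0 hmt).ne' (Real.exp_pos _).ne', Real.log_exp,
    Real.log_exp, ENNReal.toReal_one, Real.log_one]
  ring

end Comparison

/-! ### Calculus of cross-covariance matrices. -/

section CrossCov

variable {Ω : Type*} [MeasurableSpace Ω] {P : Measure Ω} {l m n : ℕ}

theorem memLp_mulVec (A : Matrix (Fin l) (Fin m) ℝ) {V : Ω → Fin m → ℝ}
    (hV : ∀ i, MemLp (fun ω => V ω i) 2 P) (i : Fin l) :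
    MemLp (fun ω => (A *ᵥ V ω) i) 2 P :=
  memLp_finsetSum Finset.univ (f := fun j ω => A i j * V ω j) fun j _ => (hV j).const_mul _

theorem integral_mulVec_eq_zero (A : Matrix (Fin l) (Fin m) ℝ) {V : Ω → Fin m → ℝ}
    (hV : ∀ i, Integrable (fun ω => V ω i) P) (h0 : ∀ i, ∫ ω, V ω i ∂P = 0) (i : Fin l) :
    ∫ ω, (A *ᵥ V ω) i ∂P = 0 := by
  simp only [mulVec, dotProduct]
  rw [integral_finsetSum _ fun j _ => (hV j).const_mul _]
  simp [integral_const_mul, h0]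

theorem crossCov_transpose (V : Ω → Fin m → ℝ) (W : Ω → Fin n → ℝ) :
    (crossCov P V W)ᵀ = crossCov P W V := by
  ext i j
  simp [crossCov, covariance_comm]

theorem crossCov_eq_zero_of_indepFun {V : Ω → Fin m → ℝ} {W : Ω → Fin n → ℝ}
    (hV : ∀ i, MemLp (fun ω => V ω i) 2 P) (hW : ∀ i, MemLp (fun ω => W ω i) 2 P)
    (h : IndepFun V W P) : crossCov P V W = 0 := by
  ext i j
  exact (h.comp (measurable_pi_apply i) (measurable_pi_apply j)).covariance_eq_zero (hV i) (hW j)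

variable [IsProbabilityMeasure P] {V V' : Ω → Fin m → ℝ} {W W' : Ω → Fin n → ℝ}

theorem crossCov_mulVec_left (A : Matrix (Fin l) (Fin m) ℝ)
    (hV : ∀ i, MemLp (fun ω => V ω i) 2 P) (hW : ∀ i, MemLp (fun ω => W ω i) 2 P) :
    crossCov P (fun ω => A *ᵥ V ω) W = A * crossCov P V W := by
  ext i j
  simp only [crossCov, of_apply, mul_apply, mulVec, dotProduct]
  rw [covariance_fun_sum_left (fun k => (hV k).const_mul _) (hW j)]
  simp [covariance_const_mul_left]

theorem crossCov_mulVec_right (A : Matrix (Fin l) (Fin n) ℝ)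
    (hV : ∀ i, MemLp (fun ω => V ω i) 2 P) (hW : ∀ i, MemLp (fun ω => W ω i) 2 P) :
    crossCov P V (fun ω => A *ᵥ W ω) = crossCov P V W * Aᵀ := by
  rw [← crossCov_transpose, crossCov_mulVec_left A hW hV, transpose_mul, crossCov_transpose]

theorem crossCov_add_left (hV : ∀ i, MemLp (fun ω => V ω i) 2 P)
    (hV' : ∀ i, MemLp (fun ω => V' ω i) 2 P) (hW : ∀ i, MemLp (fun ω => W ω i) 2 P) :
    crossCov P (fun ω => V ω + V' ω) W = crossCov P V W + crossCov P V' W := by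
  ext i j
  exact covariance_add_left (hV i) (hV' i) (hW j)

theorem crossCov_add_right (hV : ∀ i, MemLp (fun ω => V ω i) 2 P)
    (hW : ∀ i, MemLp (fun ω => W ω i) 2 P) (hW' : ∀ i, MemLp (fun ω => W' ω i) 2 P) :
    crossCov P V (fun ω => W ω + W' ω) = crossCov P V W + crossCov P V W' := by
  ext i j
  exact covariance_add_right (hV i) (hW j) (hW' j)

theorem crossCov_sub_left (hV : ∀ i, MemLp (fun ω => V ω i) 2 P)
    (hV' : ∀ i, MemLp (fun ω => V' ω i) 2 P) (hW : ∀ i, MemLp (fun ω => W ω i) 2 P) :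
    crossCov P (fun ω => V ω - V' ω) W = crossCov P V W - crossCov P V' W := by
  ext i j
  exact covariance_sub_left (hV i) (hV' i) (hW j)

theorem crossCov_sub_right (hV : ∀ i, MemLp (fun ω => V ω i) 2 P)
    (hW : ∀ i, MemLp (fun ω => W ω i) 2 P) (hW' : ∀ i, MemLp (fun ω => W' ω i) 2 P) :
    crossCov P V (fun ω => W ω - W' ω) = crossCov P V W - crossCov P V W' := by
  ext i j
  exact covariance_sub_right (hV i) (hW j) (hW' j)

/-- The quadratic form at `x` is the variance of `∑ i, x i * V i`. -/
theorem crossCov_self_posSemidef (hV : ∀ i, MemLp (fun ω => V ω i) 2 P) :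
    (crossCov P V V).PosSemidef := by
  refine .of_dotProduct_mulVec_nonneg (by
    rw [IsHermitian, conjTranspose_eq_transpose_of_trivial, crossCov_transpose]) fun x => ?_
  have h : star x ⬝ᵥ crossCov P V V *ᵥ x =
      cov[fun ω => ∑ i, x i * V ω i, fun ω => ∑ i, x i * V ω i; P] := by
    rw [covariance_fun_sum_fun_sum (fun i => (hV i).const_mul _) fun i => (hV i).const_mul _]
    simp only [covariance_const_mul_left, covariance_const_mul_right, dotProduct, mulVec,
      crossCov, of_apply, Finset.mul_sum, star_trivial]
    exact Finset.sum_congr rfl fun i _ => Finset.sum_congr rfl fun j _ => by ring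
  rw [h, covariance_self (memLp_finsetSum _ fun i _ => (hV i).const_mul _).aemeasurable]
  exact variance_nonneg _ _

theorem integral_mul_eq_crossCov (hV : ∀ i, MemLp (fun ω => V ω i) 2 P)
    (hW : ∀ i, MemLp (fun ω => W ω i) 2 P) (h0 : ∀ i, ∫ ω, V ω i ∂P = 0) (i : Fin m) (j : Fin n) :
    ∫ ω, V ω i * W ω j ∂P = crossCov P V W i j := by
  rw [crossCov, of_apply, covariance_eq_sub (hV i) (hW j), h0 i]
  simp

/-- The mean of a quadratic form of a centred random vector. -/
theorem integral_dotProduct_mulVec (A : Matrix (Fin m) (Fin m) ℝ)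
    (hV : ∀ i, MemLp (fun ω => V ω i) 2 P) (h0 : ∀ i, ∫ ω, V ω i ∂P = 0) :
    Integrable (fun ω => V ω ⬝ᵥ A *ᵥ V ω) P ∧
      ∫ ω, V ω ⬝ᵥ A *ᵥ V ω ∂P = (A * crossCov P V V).trace := by
  have hint : ∀ i j, Integrable (fun ω => V ω i * V ω j) P := fun i j =>
    (hV i).integrable_mul (hV j)
  have hint2 : ∀ i j, Integrable (fun ω => A i j * (V ω j * V ω i)) P := fun i j =>
    (hint j i).const_mul _
  have h : (fun ω => V ω ⬝ᵥ A *ᵥ V ω) = fun ω => ∑ i, ∑ j, A i j * (V ω j * V ω i) := by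
    ext ω
    simp only [dotProduct, mulVec, Finset.mul_sum]
    exact Finset.sum_congr rfl fun i _ => Finset.sum_congr rfl fun j _ => by ring
  rw [h]
  refine ⟨integrable_finsetSum _ fun i _ => integrable_finsetSum _ fun j _ => hint2 i j, ?_⟩
  rw [integral_finsetSum _ fun i _ => integrable_finsetSum _ fun j _ => hint2 i j]
  simp only [trace, diag, mul_apply]
  refine Finset.sum_congr rfl fun i _ => ?_
  rw [integral_finsetSum _ fun j _ => hint2 i j]
  refine Finset.sum_congr rfl fun j _ => ?_
  rw [integral_const_mul, integral_mul_eq_crossCov hV hV h0]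

/-- The orthogonality principle. Taking the normal equations as hypothesis avoids inverting the
covariance of `W`. -/
theorem crossCov_sub_mulVec_left {K : Matrix (Fin m) (Fin n) ℝ}
    (hV : ∀ i, MemLp (fun ω => V ω i) 2 P) (hW : ∀ i, MemLp (fun ω => W ω i) 2 P)
    (hK : crossCov P V W = K * crossCov P W W) :
    crossCov P (fun ω => V ω - K *ᵥ W ω) W = 0 := by
  rw [crossCov_sub_left hV (memLp_mulVec K hW) hW, crossCov_mulVec_left K hW hW, hK, sub_self]

/-- The error covariance of the best linear estimate `K *ᵥ W` of `V`. -/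
theorem crossCov_sub_mulVec_self {K : Matrix (Fin m) (Fin n) ℝ}
    (hV : ∀ i, MemLp (fun ω => V ω i) 2 P) (hW : ∀ i, MemLp (fun ω => W ω i) 2 P)
    (hK : crossCov P V W = K * crossCov P W W) :
    crossCov P (fun ω => V ω - K *ᵥ W ω) (fun ω => V ω - K *ᵥ W ω) =
      crossCov P V V - K * crossCov P W V := by
  have hKW := memLp_mulVec K hW
  have hR : ∀ i, MemLp (fun ω => (V ω - K *ᵥ W ω) i) 2 P := fun i => (hV i).sub (hKW i)
  rw [crossCov_sub_right hR hV hKW, crossCov_mulVec_right K hR hW,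
    crossCov_sub_mulVec_left hV hW hK, Matrix.zero_mul, sub_zero, crossCov_sub_left hV hKW hV,
    crossCov_mulVec_left K hW hV]

end CrossCov

/-! ### Densities and conditional densities of Gaussian vectors. -/

section GaussianDensity

/-- The logarithm of the density of the centred Gaussian law with covariance matrix `C`. -/
def gaussianLog {n : ℕ} (C : Matrix (Fin n) (Fin n) ℝ) (x : Fin n → ℝ) : ℝ :=
  -(1 / 2) * (Real.log ((2 * Real.pi) • C).det + x ⬝ᵥ C⁻¹ *ᵥ x)

theorem measurable_gaussianLog {n : ℕ} (C : Matrix (Fin n) (Fin n) ℝ) :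
    Measurable (gaussianLog C) := by
  unfold gaussianLog
  simp only [dotProduct, mulVec]
  fun_prop

variable {Ω : Type*} [MeasurableSpace Ω] {P : Measure Ω} {m n : ℕ}

theorem hasGaussianLaw_mulVec (A : Matrix (Fin m) (Fin n) ℝ) {V : Ω → Fin n → ℝ}
    (hV : HasGaussianLaw V P) : HasGaussianLaw (fun ω => A *ᵥ V ω) P :=
  hV.map_fun (LinearMap.toContinuousLinearMap A.mulVecLin)

theorem memLp_of_hasGaussianLaw {V : Ω → Fin n → ℝ} (hV : HasGaussianLaw V P) (i : Fin n) :
    MemLp (fun ω => V ω i) 2 P :=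
  HasGaussianLaw.memLp_two (hV.eval (X := fun i ω => V ω i) i)

theorem pi_gaussianReal_eq_withDensity :
    Measure.pi (fun _ : Fin n => gaussianReal 0 1) =
      volume.withDensity fun x => ENNReal.ofReal (∏ i, gaussianPDFReal 0 1 (x i)) := by
  refine Measure.pi_eq fun s hs => ?_
  rw [withDensity_apply _ (MeasurableSet.univ_pi hs), volume_pi, Measure.restrict_pi_pi]
  have hint : ∀ i, Integrable (gaussianPDFReal 0 1) (volume.restrict (s i)) := fun i =>
    (integrable_gaussianPDFReal 0 1).restrict
  rw [← ofReal_integral_eq_lintegral_ofReal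
    (Integrable.fintype_prod (f := fun _ => gaussianPDFReal 0 1) hint)
    (ae_of_all _ fun x => Finset.prod_nonneg fun i _ => gaussianPDFReal_nonneg _ _ _),
    integral_fintype_prod_eq_prod (f := fun _ => gaussianPDFReal 0 1),
    ENNReal.ofReal_prod_of_nonneg fun i _ => integral_nonneg fun x => gaussianPDFReal_nonneg _ _ _]
  refine Finset.prod_congr rfl fun i _ => ?_
  rw [gaussianReal_apply_eq_integral _ (by simp)]

/-- Uncorrelated coordinates of a Gaussian vector are independent, and each is standard normal. -/
theorem map_eq_pi_gaussianReal {W : Ω → Fin n → ℝ} (hW : HasGaussianLaw W P)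
    (h0 : ∀ i, ∫ ω, W ω i ∂P = 0) (hcov : crossCov P W W = 1) :
    P.map W = Measure.pi fun _ => gaussianReal 0 1 := by
  have := hW.isProbabilityMeasure
  have hc : ∀ i j, cov[fun ω => W ω i, fun ω => W ω j; P] = (1 : Matrix _ _ ℝ) i j := fun i j => by
    rw [← hcov]; rfl
  have hi := HasGaussianLaw.iIndepFun_of_covariance_eq_zero (X := fun i ω => W ω i) hW
    fun i j hij => by rw [hc, one_apply_ne hij]
  have hae : ∀ i, AEMeasurable (fun ω => W ω i) P := fun i =>
    (memLp_of_hasGaussianLaw hW i).aemeasurable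
  rw [iIndepFun_iff_map_fun_eq_pi_map hae] at hi
  refine hi.trans ?_
  congr 1
  ext1 i
  have hg := (HasGaussianLaw.eval (X := fun i ω => W ω i) hW i).map_eq_gaussianReal
  rw [hg, h0 i, ← covariance_self (hae i), hc, one_apply_eq, Real.toNNReal_one]

/-- Supplies the matrix whose inverse whitens a vector of covariance `C`. It is invertible because
the square of its determinant is `det C > 0`. -/
theorem exists_mul_transpose_eq {C : Matrix (Fin n) (Fin n) ℝ} (hC : C.PosDef) :
    ∃ A : Matrix (Fin n) (Fin n) ℝ, A * Aᵀ = C ∧ IsUnit A.det := by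
  open scoped MatrixOrder in
  obtain ⟨B, hB⟩ := CStarAlgebra.nonneg_iff_eq_star_mul_self.mp hC.posSemidef.nonneg
  rw [star_eq_conjTranspose] at hB
  refine ⟨Bᵀ, by simpa using hB.symm, ?_⟩
  have h := hC.det_pos
  rw [hB, det_mul, conjTranspose_eq_transpose_of_trivial, det_transpose] at h
  rw [det_transpose, isUnit_iff_ne_zero]
  rintro h0
  simp [h0] at h

theorem prod_gaussianPDFReal (x : Fin n → ℝ) :
    ∏ i, gaussianPDFReal 0 1 (x i) =
      Real.exp (-(1 / 2) * (n * Real.log (2 * Real.pi) + x ⬝ᵥ x)) := by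
  have h : ∀ y, gaussianPDFReal 0 1 y = Real.exp (-(1 / 2) * (Real.log (2 * Real.pi) + y * y)) := by
    intro y
    rw [gaussianPDFReal, mul_add, Real.exp_add]
    congr 1
    · rw [NNReal.coe_one, mul_one, Real.sqrt_eq_rpow, ← Real.rpow_neg (by positivity),
        Real.rpow_def_of_pos (by positivity), mul_comm]
    · congr 1
      simp; ring
  simp_rw [h, ← Real.exp_sum, ← Finset.mul_sum, Finset.sum_add_distrib]
  simp [dotProduct]

/-- The change of variables `x = A w` at the level of densities; `|A.det⁻¹|` is its Jacobian factor.
-/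
theorem gaussianLog_mul_transpose {A : Matrix (Fin n) (Fin n) ℝ} (hA : IsUnit A.det)
    (x : Fin n → ℝ) :
    Real.exp (gaussianLog (A * Aᵀ) x) =
      |A.det⁻¹| * ∏ i, gaussianPDFReal 0 1 ((A⁻¹ *ᵥ x) i) := by
  have h0 : A.det ≠ 0 := hA.ne_zero
  rw [prod_gaussianPDFReal, gaussianLog, det_smul, det_mul, det_transpose, Fintype.card_fin,
    Real.log_mul (by positivity) (mul_ne_zero h0 h0), Real.log_pow, Real.log_mul h0 h0,
    abs_inv, ← Real.exp_log (abs_pos.2 h0), ← Real.exp_neg, ← Real.exp_add, Real.log_abs]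
  congr 1
  have : x ⬝ᵥ (A * Aᵀ)⁻¹ *ᵥ x = A⁻¹ *ᵥ x ⬝ᵥ A⁻¹ *ᵥ x := by
    rw [Matrix.mul_inv_rev, ← mulVec_mulVec, dotProduct_mulVec, ← transpose_nonsing_inv,
      vecMul_transpose]
  rw [this]
  ring

/-- A centred Gaussian vector with nonsingular covariance matrix has the Gaussian density. -/
theorem map_eq_withDensity_gaussian {X : Ω → Fin n → ℝ} (hXm : Measurable X)
    (hX : HasGaussianLaw X P) (h0 : ∀ i, ∫ ω, X ω i ∂P = 0) {C : Matrix (Fin n) (Fin n) ℝ}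
    (hcov : crossCov P X X = C) (hC : C.PosDef) :
    P.map X = volume.withDensity fun x => ENNReal.ofReal (Real.exp (gaussianLog C x)) := by
  have := hX.isProbabilityMeasure
  obtain ⟨A, rfl, hA⟩ := exists_mul_transpose_eq hC
  have hX2 := memLp_of_hasGaussianLaw hX
  have hAx : ∀ M : Matrix (Fin n) (Fin n) ℝ, Measurable fun x : Fin n → ℝ => M *ᵥ x := fun M =>
    (LinearMap.toContinuousLinearMap M.mulVecLin).continuous.measurable
  -- Whitening: `A⁻¹ X` is Gaussian with identity covariance, so its law is the standard product
  -- law. The density of `X` follows by the linear substitution below.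
  have hWlaw : P.map (fun ω => A⁻¹ *ᵥ X ω) = Measure.pi fun _ => gaussianReal 0 1 := by
    refine map_eq_pi_gaussianReal (hasGaussianLaw_mulVec _ hX)
      (integral_mulVec_eq_zero _ (fun i => (hX2 i).integrable one_le_two) h0) ?_
    rw [crossCov_mulVec_left _ hX2 (memLp_mulVec _ hX2), crossCov_mulVec_right _ hX2 hX2, hcov,
      ← Matrix.mul_assoc, ← Matrix.mul_assoc, nonsing_inv_mul _ hA, Matrix.one_mul,
      transpose_nonsing_inv, mul_nonsing_inv _ (by rwa [det_transpose])]
  rw [pi_gaussianReal_eq_withDensity] at hWlaw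
  have hpdf : Measurable (gaussianPDFReal 0 1) := measurable_gaussianPDFReal 0 1
  refine map_eq_withDensity_of_lintegral hXm (measurable_gaussianLog _).exp.ennreal_ofReal
    fun g hg => ?_
  have hinv : ∀ x, A⁻¹ *ᵥ A *ᵥ x = x := fun x => by
    rw [mulVec_mulVec, nonsing_inv_mul _ hA, one_mulVec]
  have hinv' : ∀ x, A *ᵥ A⁻¹ *ᵥ x = x := fun x => by
    rw [mulVec_mulVec, mul_nonsing_inv _ hA, one_mulVec]
  have hdens : Measurable fun x : Fin n → ℝ =>
      ENNReal.ofReal (∏ i, gaussianPDFReal 0 1 (x i)) := by fun_prop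
  have hdens' : Measurable fun x : Fin n → ℝ =>
      ENNReal.ofReal (∏ i, gaussianPDFReal 0 1 ((A⁻¹ *ᵥ x) i)) := hdens.comp (hAx _)
  calc ∫⁻ ω, g (X ω) ∂P = ∫⁻ ω, g (A *ᵥ (A⁻¹ *ᵥ X ω)) ∂P := by simp_rw [hinv']
    _ = ∫⁻ w, ENNReal.ofReal (∏ i, gaussianPDFReal 0 1 (w i)) * g (A *ᵥ w) :=
      lintegral_comp_eq_of_map_eq ((hAx _).comp hXm) hdens hWlaw (g := fun w => g (A *ᵥ w))
        (hg.comp (hAx _))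
    _ = ∫⁻ w, (fun x => ENNReal.ofReal (∏ i, gaussianPDFReal 0 1 ((A⁻¹ *ᵥ x) i)) * g x)
          (A *ᵥ w) := by simp_rw [hinv]
    _ = ∫⁻ x, ENNReal.ofReal (∏ i, gaussianPDFReal 0 1 ((A⁻¹ *ᵥ x) i)) * g x
          ∂(volume.map (toLin' A)) :=
      (lintegral_map (hdens'.mul hg) (hAx A)).symm
    _ = _ := by
      rw [Real.map_matrix_volume_pi_eq_smul_volume_pi hA.ne_zero, lintegral_smul_measure,
        smul_eq_mul]
      refine (lintegral_const_mul _ (hdens'.mul hg)).symm.trans ?_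
      refine lintegral_congr fun x => ?_
      rw [gaussianLog_mul_transpose hA, ENNReal.ofReal_mul (abs_nonneg _), mul_assoc]
      rfl

theorem measurable_mulVec (A : Matrix (Fin m) (Fin n) ℝ) :
    Measurable fun x : Fin n → ℝ => A *ᵥ x :=
  (LinearMap.toContinuousLinearMap A.mulVecLin).continuous.measurable

/-- The conditional density of `V` given `W` when `(W, V)` is jointly Gaussian. -/
theorem map_prodMk_eq_withDensity_gaussian {W : Ω → Fin m → ℝ} {V : Ω → Fin n → ℝ}
    (hWm : Measurable W) (hVm : Measurable V) (hWV : HasGaussianLaw (fun ω => (W ω, V ω)) P)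
    (hV0 : ∀ i, ∫ ω, V ω i ∂P = 0) (hW0 : ∀ i, ∫ ω, W ω i ∂P = 0)
    {K : Matrix (Fin n) (Fin m) ℝ} {C : Matrix (Fin n) (Fin n) ℝ} (hC : C.PosDef)
    (hK : crossCov P V W = K * crossCov P W W)
    (hcov : crossCov P V V - K * crossCov P W V = C) :
    P.map (fun ω => (W ω, V ω)) = ((P.map W).prod volume).withDensity
      fun x => ENNReal.ofReal (Real.exp (gaussianLog C (x.2 - K *ᵥ x.1))) := by
  have := hWV.isProbabilityMeasure
  have := Measure.isProbabilityMeasure_map (μ := P) hWm.aemeasurable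
  have hW2 := memLp_of_hasGaussianLaw hWV.fst
  have hV2 := memLp_of_hasGaussianLaw hWV.snd
  have hKm := measurable_mulVec K
  have hKW2 := memLp_mulVec K hW2
  -- The residual of the linear estimate is uncorrelated with `W`, hence independent of it by joint
  -- Gaussianity. Given `W`, the vector `V` is a translate of `R`.
  set R : Ω → Fin n → ℝ := fun ω => V ω - K *ᵥ W ω with hR
  have hRm : Measurable R := hVm.sub (hKm.comp hWm)
  have hWR : HasGaussianLaw (fun ω => (W ω, R ω)) P :=
    hWV.map_fun ((ContinuousLinearMap.fst ℝ _ _).prod (ContinuousLinearMap.snd ℝ _ _ -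
      (LinearMap.toContinuousLinearMap K.mulVecLin).comp (ContinuousLinearMap.fst ℝ _ _)))
  have hWR0 : crossCov P W R = 0 := by
    rw [← crossCov_transpose, crossCov_sub_mulVec_left hV2 hW2 hK, transpose_zero]
  have hRR : crossCov P R R = C := by rw [← hcov, ← crossCov_sub_mulVec_self hV2 hW2 hK]
  have hind : IndepFun W R P :=
    HasGaussianLaw.indepFun_of_covariance_eval (X := fun i ω => W ω i) (Y := fun i ω => R ω i) hWR
      fun i j => congrFun (congrFun hWR0 i) j
  have hR0 : ∀ i, ∫ ω, R ω i ∂P = 0 := fun i => by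
    have h1 := integral_mulVec_eq_zero K (fun i => (hW2 i).integrable one_le_two) hW0 i
    have : ∫ ω, R ω i ∂P = ∫ ω, V ω i ∂P - ∫ ω, (K *ᵥ W ω) i ∂P :=
      integral_sub ((hV2 i).integrable one_le_two) ((hKW2 i).integrable one_le_two)
    rw [this, h1, hV0, sub_zero]
  have hRlaw := map_eq_withDensity_gaussian hRm hWR.snd hR0 hRR hC
  have hGm := (measurable_gaussianLog C).exp.ennreal_ofReal
  have hGm' : Measurable fun x : (Fin m → ℝ) × (Fin n → ℝ) =>
      ENNReal.ofReal (Real.exp (gaussianLog C (x.2 - K *ᵥ x.1))) :=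
    hGm.comp (measurable_snd.sub (hKm.comp measurable_fst))
  refine map_eq_withDensity_of_lintegral (hWm.prodMk hVm) hGm' fun g hg => ?_
  have hg' : Measurable fun x : (Fin m → ℝ) × (Fin n → ℝ) => g (x.1, x.2 + K *ᵥ x.1) :=
    hg.comp (measurable_fst.prodMk (measurable_snd.add (hKm.comp measurable_fst)))
  calc ∫⁻ ω, g (W ω, V ω) ∂P
      = ∫⁻ ω, (fun x : (Fin m → ℝ) × (Fin n → ℝ) => g (x.1, x.2 + K *ᵥ x.1)) (W ω, R ω) ∂P := by
        simp [hR]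
    _ = ∫⁻ x, g (x.1, x.2 + K *ᵥ x.1) ∂(P.map W).prod (P.map R) := by
        rw [← (indepFun_iff_map_prod_eq_prod_map_map hWm.aemeasurable hRm.aemeasurable).1 hind,
          lintegral_map hg' (hWm.prodMk hRm)]
    _ = ∫⁻ w, ∫⁻ r, g (w, r + K *ᵥ w) ∂(P.map R) ∂(P.map W) := by
        have := Measure.isProbabilityMeasure_map (μ := P) hRm.aemeasurable
        exact lintegral_prod _ hg'.aemeasurable
    _ = ∫⁻ w, ∫⁻ v, ENNReal.ofReal (Real.exp (gaussianLog C (v - K *ᵥ w))) * g (w, v) ∂volume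
          ∂(P.map W) := by
        refine lintegral_congr fun w => ?_
        rw [hRlaw, lintegral_withDensity_eq_lintegral_mul _ hGm
          (g := fun r => g (w, r + K *ᵥ w)) (hg'.comp (measurable_const.prodMk measurable_id)),
          ← lintegral_add_right_eq_self
            (fun v => ENNReal.ofReal (Real.exp (gaussianLog C (v - K *ᵥ w))) * g (w, v)) (K *ᵥ w)]
        simp
    _ = _ := (lintegral_prod (fun x : (Fin m → ℝ) × (Fin n → ℝ) =>
          ENNReal.ofReal (Real.exp (gaussianLog C (x.2 - K *ᵥ x.1))) * g x)
          (hGm'.mul hg).aemeasurable).symm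

/-- Gaussian vectors with prescribed positive definite covariance matrix exist, so that the
Gaussian density integrates to one. -/
theorem lintegral_exp_gaussianLog {C : Matrix (Fin n) (Fin n) ℝ} (hC : C.PosDef) :
    ∫⁻ x, ENNReal.ofReal (Real.exp (gaussianLog C x)) = 1 := by
  set P := multivariateGaussian 0 C
  set X : EuclideanSpace ℝ (Fin n) → Fin n → ℝ := fun x => x.ofLp
  have hXm : Measurable X := by fun_prop
  have hX : HasGaussianLaw X P :=
    (IsGaussian.hasGaussianLaw_id (μ := P)).map_fun
      (PiLp.continuousLinearEquiv 2 ℝ fun _ : Fin n => ℝ).toContinuousLinearMap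
  have h := map_eq_withDensity_gaussian hXm hX (C := C) (fun i => ?_) ?_ hC
  · exact lintegral_density_eq_one hXm (measurable_gaussianLog C).exp.ennreal_ofReal h
  · have := ContinuousLinearMap.integral_comp_comm (EuclideanSpace.proj (𝕜 := ℝ) i)
      (IsGaussian.integrable_fun_id (μ := P))
    rw [integral_id_multivariateGaussian] at this
    simpa using this
  · ext i j
    exact covariance_eval_multivariateGaussian hC.posSemidef i j

end GaussianDensity

/-! ### Measurability of matrix operations. -/

section MatrixMeasurability

variable {Ω : Type*} [MeasurableSpace Ω] {l m n : ℕ}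

theorem measurable_matrix_iff {f : Ω → Matrix (Fin m) (Fin n) ℝ} :
    Measurable f ↔ ∀ i j, Measurable fun ω => f ω i j := by
  refine Iff.trans (measurable_pi_iff (X := fun _ : Fin m => Fin n → ℝ)) ?_
  exact forall_congr' fun i => measurable_pi_iff (X := fun _ : Fin n => ℝ)

variable {A : Ω → Matrix (Fin l) (Fin m) ℝ} {B : Ω → Matrix (Fin m) (Fin n) ℝ}
  {C : Ω → Matrix (Fin n) (Fin n) ℝ}

theorem Measurable.entry (hA : Measurable A) (i : Fin l) (j : Fin m) :
    Measurable fun ω => A ω i j := measurable_matrix_iff.1 hA i j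

theorem Measurable.matrixMul (hA : Measurable A) (hB : Measurable B) :
    Measurable fun ω => A ω * B ω := by
  rw [measurable_matrix_iff]
  intro i j
  simp only [mul_apply]
  exact Finset.measurable_sum _ fun k _ => (Measurable.entry hA i k).mul (Measurable.entry hB k j)

theorem Measurable.matrixTranspose (hA : Measurable A) : Measurable fun ω => (A ω)ᵀ := by
  rw [measurable_matrix_iff]
  exact fun i j => Measurable.entry hA j i

theorem Measurable.matrixAdd {A' : Ω → Matrix (Fin l) (Fin m) ℝ} (hA : Measurable A)
    (hA' : Measurable A') : Measurable fun ω => A ω + A' ω := by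
  rw [measurable_matrix_iff]
  exact fun i j => (Measurable.entry hA i j).add (Measurable.entry hA' i j)

theorem Measurable.matrixSub {A' : Ω → Matrix (Fin l) (Fin m) ℝ} (hA : Measurable A)
    (hA' : Measurable A') : Measurable fun ω => A ω - A' ω := by
  rw [measurable_matrix_iff]
  exact fun i j => (Measurable.entry hA i j).sub (Measurable.entry hA' i j)

theorem Measurable.matrixDet (hC : Measurable C) : Measurable fun ω => (C ω).det := by
  simp only [det_apply]
  exact Finset.measurable_sum _ fun s _ => Measurable.const_smul
    (Finset.measurable_prod _ fun i _ => Measurable.entry hC _ _) _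

theorem Measurable.matrixInv (hC : Measurable C) : Measurable fun ω => (C ω)⁻¹ := by
  rw [measurable_matrix_iff]
  intro i j
  -- The inverse is the adjugate times the inverse determinant, with value `0` at singular matrices,
  -- so no invertibility is required. The adjugate entries are themselves determinants.
  simp only [inv_def, Matrix.smul_apply, smul_eq_mul, Ring.inverse_eq_inv', adjugate_apply]
  refine (Measurable.matrixDet hC).inv.mul (Measurable.matrixDet ?_)
  rw [measurable_matrix_iff]
  intro k l
  by_cases h : k = j
  · subst h
    simp
  · simpa [updateRow_ne h] using Measurable.entry hC k l

theorem Measurable.matrixMulVec {v : Ω → Fin m → ℝ} (hA : Measurable A) (hv : Measurable v) :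
    Measurable fun ω => A ω *ᵥ v ω := by
  rw [measurable_pi_iff]
  intro i
  simp only [mulVec, dotProduct]
  exact Finset.measurable_sum _ fun k _ => (Measurable.entry hA i k).mul
    ((measurable_pi_apply k).comp hv)

theorem Measurable.gaussianLog {v : Ω → Fin n → ℝ} (hC : Measurable C) (hv : Measurable v) :
    Measurable fun ω => gaussianLog (C ω) (v ω) := by
  unfold FadingPaper.gaussianLog
  simp only [det_smul]
  have h1 := Measurable.matrixDet hC
  have h2 := Measurable.matrixMulVec (Measurable.matrixInv hC) hv
  simp only [dotProduct]
  fun_prop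

end MatrixMeasurability

/-! ### Second moments of an assignment and positivity of the error covariances. -/

namespace Setting

variable {M N : ℕ} (σ : Setting M)

theorem measurable_covUY : Measurable (σ.covUY (N := N)) :=
  Measurable.matrixMul measurable_const (Measurable.matrixTranspose measurable_id)

theorem measurable_covY (covZ : Matrix (Fin N) (Fin N) ℝ) : Measurable (σ.covY covZ) :=
  Measurable.matrixAdd (Measurable.matrixMul (Measurable.matrixMul measurable_id measurable_const)
    (Measurable.matrixTranspose measurable_id)) measurable_const

theorem measurable_gain (covZ : Matrix (Fin N) (Fin N) ℝ) : Measurable (σ.gain covZ) :=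
  Measurable.matrixMul σ.measurable_covUY (Measurable.matrixInv (σ.measurable_covY covZ))

theorem measurable_errCov (covZ : Matrix (Fin N) (Fin N) ℝ) : Measurable (σ.errCov covZ) :=
  Measurable.matrixSub measurable_const
    (Measurable.matrixMul (σ.measurable_gain covZ) (Measurable.matrixTranspose σ.measurable_covUY))

/-- The matrix of the best linear estimate of `U` from `S`. -/
def gainS : Matrix (Fin M) (Fin M) ℝ := σ.covSUᵀ * σ.covS⁻¹

/-- The conditional covariance matrix of `U` given `S`. -/
def condCov : Matrix (Fin M) (Fin M) ℝ := σ.covU - σ.gainS * σ.covSU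

variable {σ}

theorem covS_posDef (h : σ.covSUJoint.PosDef) : σ.covS.PosDef :=
  h.submatrix (Sum.inl_injective)

theorem covU_posDef (h : σ.covSUJoint.PosDef) : σ.covU.PosDef :=
  h.submatrix (Sum.inr_injective)

/-- `condCov` is the Schur complement of `covS` in the covariance of `(S, U)`. It is positive
semidefinite by the Schur criterion, and its determinant is nonzero because the block determinant is
the product of the two. -/
theorem condCov_posDef (h : σ.covSUJoint.PosDef) : σ.condCov.PosDef := by
  have hS := covS_posDef h
  have := hS.isUnit.invertible
  have h1 := (hS.fromBlocks₁₁ σ.covSU σ.covU).1 (by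
    rw [conjTranspose_eq_transpose_of_trivial]; exact h.posSemidef)
  rw [conjTranspose_eq_transpose_of_trivial] at h1
  refine h1.posDef_iff_det_ne_zero.2 fun h0 => ?_
  have h2 := h.det_pos
  rw [covSUJoint, det_fromBlocks₁₁, invOf_eq_nonsing_inv, h0, mul_zero] at h2
  exact lt_irrefl _ h2

end Setting

namespace LinearAssignment

variable {M N : ℕ} {σ : Setting M} {ν : Measure (Matrix (Fin N) (Fin M) ℝ)}
  {covZ : Matrix (Fin N) (Fin N) ℝ} {Ω : Type*} [MeasurableSpace Ω] {P : Measure Ω}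
  (a : LinearAssignment σ ν covZ P)

/-- The channel observation for the value `h` of the fading matrix. -/
def outputAt (h : Matrix (Fin N) (Fin M) ℝ) (ω : Ω) : Fin N → ℝ :=
  h *ᵥ (a.X ω + a.S ω) + a.Z ω

theorem measurable_U : Measurable a.U :=
  ((measurable_mulVec σ.F).comp a.measurable_S).add a.measurable_X

theorem measurable_Y : Measurable a.Y :=
  (Measurable.matrixMulVec a.measurable_H (a.measurable_X.add a.measurable_S)).add a.measurable_Z

theorem measurable_outputAt (h : Matrix (Fin N) (Fin M) ℝ) : Measurable (a.outputAt h) :=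
  ((measurable_mulVec h).comp (a.measurable_X.add a.measurable_S)).add a.measurable_Z

theorem memLp_S (i : Fin M) : MemLp (fun ω => a.S ω i) 2 P :=
  memLp_of_hasGaussianLaw a.gaussian_S i

theorem memLp_Z (i : Fin N) : MemLp (fun ω => a.Z ω i) 2 P :=
  memLp_of_hasGaussianLaw a.gaussian_Z i

theorem cov_XS : crossCov P a.X a.S = σ.covSXᵀ := by rw [← crossCov_transpose, a.cov_SX]

theorem indep_SX_Z : IndepFun (fun ω => (a.S ω, a.X ω)) a.Z P :=
  a.indep_SX_HZ.comp measurable_id measurable_snd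

theorem memLp_U (i : Fin M) : MemLp (fun ω => a.U ω i) 2 P :=
  (memLp_mulVec σ.F a.memLp_S i).add (a.memLp_X i)

theorem memLp_sum (i : Fin M) : MemLp (fun ω => (a.X ω + a.S ω) i) 2 P :=
  (a.memLp_X i).add (a.memLp_S i)

theorem transpose_covS (a : LinearAssignment σ ν covZ P) :  σ.covSᵀ = σ.covS := by rw [← a.cov_S, crossCov_transpose]

theorem indep_sum_Z : IndepFun (fun ω => a.X ω + a.S ω) a.Z P :=
  a.indep_SX_Z.comp (measurable_snd.add measurable_fst) measurable_id

theorem indep_U_Z : IndepFun a.U a.Z P :=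
  a.indep_SX_Z.comp (((measurable_mulVec σ.F).comp measurable_fst).add measurable_snd)
    measurable_id

theorem memLp_outputAt (h : Matrix (Fin N) (Fin M) ℝ) (i : Fin N) :
    MemLp (fun ω => a.outputAt h ω i) 2 P :=
  (memLp_mulVec h a.memLp_sum i).add (a.memLp_Z i)

variable [IsProbabilityMeasure P]

theorem mean_U (i : Fin M) : ∫ ω, a.U ω i ∂P = 0 := by
  have h := integral_mulVec_eq_zero σ.F (fun i => (a.memLp_S i).integrable one_le_two) a.mean_S i
  have : ∫ ω, a.U ω i ∂P = ∫ ω, (σ.F *ᵥ a.S ω) i ∂P + ∫ ω, a.X ω i ∂P :=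
    integral_add ((memLp_mulVec σ.F a.memLp_S i).integrable one_le_two)
      ((a.memLp_X i).integrable one_le_two)
  rw [this, h, a.mean_X, add_zero]

theorem mean_sum (i : Fin M) : ∫ ω, (a.X ω + a.S ω) i ∂P = 0 := by
  have : ∫ ω, (a.X ω + a.S ω) i ∂P = ∫ ω, a.X ω i ∂P + ∫ ω, a.S ω i ∂P :=
    integral_add ((a.memLp_X i).integrable one_le_two) ((a.memLp_S i).integrable one_le_two)
  rw [this, a.mean_X, a.mean_S, add_zero]

theorem mean_outputAt (h : Matrix (Fin N) (Fin M) ℝ) (i : Fin N) :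
    ∫ ω, a.outputAt h ω i ∂P = 0 := by
  have h0 := integral_mulVec_eq_zero h (fun i => (a.memLp_sum i).integrable one_le_two)
    a.mean_sum i
  have : ∫ ω, a.outputAt h ω i ∂P =
      ∫ ω, (h *ᵥ (a.X ω + a.S ω)) i ∂P + ∫ ω, a.Z ω i ∂P :=
    integral_add ((memLp_mulVec h a.memLp_sum i).integrable one_le_two)
      ((a.memLp_Z i).integrable one_le_two)
  rw [this, h0, a.mean_Z, add_zero]

theorem cov_SU : crossCov P a.S a.U = σ.covSU := by
  unfold U
  rw [crossCov_add_right a.memLp_S (memLp_mulVec _ a.memLp_S) a.memLp_X,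
    crossCov_mulVec_right _ a.memLp_S a.memLp_S, a.cov_S, a.cov_SX]
  rfl

theorem cov_XU : crossCov P a.X a.U = σ.covSXᵀ * σ.Fᵀ + σ.covX := by
  unfold U
  rw [crossCov_add_right a.memLp_X (memLp_mulVec _ a.memLp_S) a.memLp_X,
    crossCov_mulVec_right _ a.memLp_X a.memLp_S, a.cov_XS, a.cov_X]

theorem cov_U : crossCov P a.U a.U = σ.covU := by
  conv_lhs => enter [2]; unfold U
  rw [crossCov_add_left (memLp_mulVec _ a.memLp_S) a.memLp_X a.memLp_U,
    crossCov_mulVec_left _ a.memLp_S a.memLp_U, a.cov_SU, a.cov_XU, Setting.covSU, Setting.covU,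
    Matrix.mul_add, Matrix.mul_assoc, add_assoc, add_assoc, add_assoc]

theorem cov_U_sum :
    crossCov P a.U (fun ω => a.X ω + a.S ω) =
      σ.F * σ.covS + σ.F * σ.covSX + σ.covSXᵀ + σ.covX := by
  rw [crossCov_add_right a.memLp_U a.memLp_X a.memLp_S, ← crossCov_transpose a.X,
    ← crossCov_transpose a.S, a.cov_SU, a.cov_XU, Setting.covSU, transpose_add, transpose_add,
    transpose_mul, transpose_mul, transpose_transpose, transpose_transpose, a.transpose_covS,
    ← a.cov_X, crossCov_transpose]
  abel

theorem cov_sum :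
    crossCov P (fun ω => a.X ω + a.S ω) (fun ω => a.X ω + a.S ω) =
      σ.covS + σ.covX + σ.covSX + σ.covSXᵀ := by
  rw [crossCov_add_right a.memLp_sum a.memLp_X a.memLp_S,
    crossCov_add_left a.memLp_X a.memLp_S a.memLp_X,
    crossCov_add_left a.memLp_X a.memLp_S a.memLp_S, a.cov_S, a.cov_X, a.cov_SX, a.cov_XS]
  abel

theorem cov_U_outputAt (h : Matrix (Fin N) (Fin M) ℝ) :
    crossCov P a.U (a.outputAt h) = σ.covUY h := by
  unfold outputAt
  rw [crossCov_add_right a.memLp_U (memLp_mulVec h a.memLp_sum) a.memLp_Z,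
    crossCov_mulVec_right h a.memLp_U a.memLp_sum,
    crossCov_eq_zero_of_indepFun a.memLp_U a.memLp_Z a.indep_U_Z, a.cov_U_sum, add_zero]
  rfl

theorem cov_outputAt (h : Matrix (Fin N) (Fin M) ℝ) :
    crossCov P (a.outputAt h) (a.outputAt h) = σ.covY covZ h := by
  have hT := memLp_mulVec h a.memLp_sum
  have h0 := crossCov_eq_zero_of_indepFun a.memLp_sum a.memLp_Z a.indep_sum_Z
  have h0' : crossCov P a.Z (fun ω => a.X ω + a.S ω) = 0 := by
    rw [← crossCov_transpose, h0, transpose_zero]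
  have hmem := a.memLp_outputAt h
  unfold outputAt at hmem ⊢
  rw [crossCov_add_right hmem hT a.memLp_Z, crossCov_add_left hT a.memLp_Z hT,
    crossCov_add_left hT a.memLp_Z a.memLp_Z, crossCov_mulVec_left h a.memLp_sum hT,
    crossCov_mulVec_right h a.memLp_sum a.memLp_sum, crossCov_mulVec_right h a.memLp_Z a.memLp_sum,
    crossCov_mulVec_left h a.memLp_sum a.memLp_Z, h0, h0', a.cov_sum, a.cov_Z, Setting.covY,
    Matrix.mul_zero, Matrix.zero_mul, add_zero, zero_add, Matrix.mul_assoc]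

theorem covY_posDef (a : LinearAssignment σ ν covZ P) (hZ : covZ.PosDef) (h : Matrix (Fin N) (Fin M) ℝ) :
    (σ.covY covZ h).PosDef := by
  have := crossCov_self_posSemidef (memLp_mulVec h a.memLp_sum)
  rw [crossCov_mulVec_left h a.memLp_sum (memLp_mulVec h a.memLp_sum),
    crossCov_mulVec_right h a.memLp_sum a.memLp_sum, a.cov_sum, ← Matrix.mul_assoc] at this
  exact hZ.posSemidef_add this

theorem gain_mul_cov_outputAt (hZ : covZ.PosDef) (h : Matrix (Fin N) (Fin M) ℝ) :
    crossCov P a.U (a.outputAt h) =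
      σ.gain covZ h * crossCov P (a.outputAt h) (a.outputAt h) := by
  rw [a.cov_U_outputAt, a.cov_outputAt, Setting.gain, Matrix.mul_assoc,
    nonsing_inv_mul _ ((isUnit_iff_isUnit_det _).1 (a.covY_posDef hZ h).isUnit), Matrix.mul_one]

theorem cov_U_sub_gain (h : Matrix (Fin N) (Fin M) ℝ) :
    crossCov P a.U a.U - σ.gain covZ h * crossCov P (a.outputAt h) a.U = σ.errCov covZ h := by
  rw [← crossCov_transpose a.U (a.outputAt h), a.cov_U_outputAt, a.cov_U]
  rfl

/-- For fixed `h` the estimation error is `R - K Z` with `R = U - K h (X + S)` independent of `Z`,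
so the error covariance is `Cov R + K Σ_Z Kᵀ`. On vectors with `Kᵀ x ≠ 0` the second term is
positive. If `Kᵀ x = 0`, then `(covUY h)ᵀ x = covY Kᵀ x = 0`, and the quadratic form reduces to that
of the positive definite `covU`. -/
theorem errCov_posDef (a : LinearAssignment σ ν covZ P)
    (hZ : covZ.PosDef) (hSU : σ.covSUJoint.PosDef) (h : Matrix (Fin N) (Fin M) ℝ) : (σ.errCov covZ h).PosDef := by
  set K := σ.gain covZ h with hK
  have hKG := a.gain_mul_cov_outputAt hZ h
  have hKT := memLp_mulVec (K * h) a.memLp_sum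
  set R : Ω → Fin M → ℝ := fun ω => a.U ω - (K * h) *ᵥ (a.X ω + a.S ω) with hRdef
  have hR : ∀ i, MemLp (fun ω => R ω i) 2 P := fun i => (a.memLp_U i).sub (hKT i)
  have hKZ := memLp_mulVec K a.memLp_Z
  have hRKZ : ∀ i, MemLp (fun ω => (R ω - K *ᵥ a.Z ω) i) 2 P := fun i => (hR i).sub (hKZ i)
  have hD : (fun ω => a.U ω - K *ᵥ a.outputAt h ω) = fun ω => R ω - K *ᵥ a.Z ω := by
    ext1 ω
    rw [hRdef, outputAt, mulVec_add, mulVec_mulVec, sub_sub]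
  have hind : IndepFun R a.Z P := a.indep_SX_Z.comp
    ((((measurable_mulVec σ.F).comp measurable_fst).add measurable_snd).sub
      ((measurable_mulVec (K * h)).comp (measurable_snd.add measurable_fst))) measurable_id
  have h0 : crossCov P R a.Z = 0 := crossCov_eq_zero_of_indepFun hR a.memLp_Z hind
  have h0' : crossCov P a.Z R = 0 := by rw [← crossCov_transpose, h0, transpose_zero]
  have hsplit : σ.errCov covZ h = crossCov P R R + K * covZ * Kᵀ := by
    rw [← a.cov_U_sub_gain h, ← crossCov_sub_mulVec_self a.memLp_U (a.memLp_outputAt h) hKG,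
      ← hK, hD, crossCov_sub_left hR hKZ hRKZ,
      crossCov_sub_right hR hR hKZ, crossCov_sub_right hKZ hR hKZ,
      crossCov_mulVec_left K a.memLp_Z hR, crossCov_mulVec_left K a.memLp_Z hKZ,
      crossCov_mulVec_right K a.memLp_Z a.memLp_Z, crossCov_mulVec_right K hR a.memLp_Z, h0, h0',
      a.cov_Z]
    simp [Matrix.mul_assoc]
  have hRpsd := crossCov_self_posSemidef hR
  have hKpsd : (K * covZ * Kᵀ).PosSemidef := by
    simpa using hZ.posSemidef.mul_mul_conjTranspose_same K
  refine .of_dotProduct_mulVec_pos (hsplit ▸ (hRpsd.add hKpsd).1) fun x hx => ?_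
  by_cases hKx : Kᵀ *ᵥ x = 0
  · have hG : (σ.covUY h)ᵀ *ᵥ x = 0 := by
      rw [← a.cov_U_outputAt, hKG, transpose_mul, ← mulVec_mulVec, ← hK, hKx, mulVec_zero]
    rw [Setting.errCov, sub_mulVec, ← mulVec_mulVec _ _ (σ.covUY h)ᵀ, hG, mulVec_zero, sub_zero]
    exact (Setting.covU_posDef hSU).dotProduct_mulVec_pos hx
  · rw [hsplit, add_mulVec, dotProduct_add]
    refine add_pos_of_nonneg_of_pos (hRpsd.dotProduct_mulVec_nonneg x) ?_
    have := hZ.dotProduct_mulVec_pos hKx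
    rwa [star_trivial, mulVec_transpose, ← dotProduct_mulVec, ← mulVec_transpose, mulVec_mulVec,
      mulVec_mulVec] at this

end LinearAssignment

/-! ### Joint density of `(S, U, Y, H)`. -/

theorem lintegral_withDensity_prod_prod {α β γ δ : Type*} [MeasurableSpace α] [MeasurableSpace β]
    [MeasurableSpace γ] [MeasurableSpace δ] {π : Measure α} {μ : Measure β} {μ' : Measure γ}
    {ν : Measure δ} [SFinite π] [SFinite μ] [SFinite μ'] [SFinite ν] {q : α × β → ℝ≥0∞}
    {k g : α × β × γ × δ → ℝ≥0∞} (hq : Measurable q) (hk : Measurable k) (hg : Measurable g) :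
    ∫⁻ x, ∫⁻ h, ∫⁻ y, k (x.1, x.2, y, h) * g (x.1, x.2, y, h) ∂μ' ∂ν ∂(π.prod μ).withDensity q =
      ∫⁻ x, q (x.1, x.2.1) * k x * g x ∂π.prod (μ.prod (μ'.prod ν)) := by
  have hg3 : Measurable fun p : ((α × β) × δ) × γ =>
      k (p.1.1.1, p.1.1.2, p.2, p.1.2) * g (p.1.1.1, p.1.1.2, p.2, p.1.2) := by fun_prop
  have hg2 : Measurable fun x : α × β =>
      ∫⁻ h, ∫⁻ y, k (x.1, x.2, y, h) * g (x.1, x.2, y, h) ∂μ' ∂ν :=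
    Measurable.lintegral_prod_right' (f := fun p : (α × β) × δ =>
      ∫⁻ y, k (p.1.1, p.1.2, y, p.2) * g (p.1.1, p.1.2, y, p.2) ∂μ')
        (Measurable.lintegral_prod_right' hg3)
  have hd : Measurable fun x : α × β × γ × δ => q (x.1, x.2.1) * k x * g x := by fun_prop
  rw [lintegral_withDensity_eq_lintegral_mul _ hq hg2, lintegral_prod _ (hq.mul hg2).aemeasurable,
    lintegral_prod _ hd.aemeasurable]
  refine lintegral_congr fun s => ?_
  have hs : Measurable fun x : β × γ × δ => q (s, x.1) * k (s, x) * g (s, x) := by fun_prop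
  rw [lintegral_prod _ hs.aemeasurable]
  refine lintegral_congr fun u => ?_
  have hm : Measurable fun p : γ × δ => k (s, u, p) * g (s, u, p) := by fun_prop
  have hm' : Measurable fun p : δ × γ => k (s, u, p.2, p.1) * g (s, u, p.2, p.1) := by fun_prop
  simp only [Pi.mul_apply, mul_assoc]
  rw [lintegral_const_mul _ hm, lintegral_prod _ hm.aemeasurable,
    lintegral_lintegral_swap hm'.aemeasurable]

namespace Setting

variable {M N : ℕ} (σ : Setting M)

/-- The law of the interference. -/
def lawS : Measure (Fin M → ℝ) :=
  volume.withDensity fun s => ENNReal.ofReal (Real.exp (gaussianLog σ.covS s))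

/-- The logarithm of the Gaussian conditional density of `U` given `S`. -/
def logDensityS (x : (Fin M → ℝ) × (Fin M → ℝ)) : ℝ :=
  gaussianLog σ.condCov (x.2 - σ.gainS *ᵥ x.1)

/-- The Gaussian conditional density of `U` given `S`. -/
def densityS (x : (Fin M → ℝ) × (Fin M → ℝ)) : ℝ≥0∞ :=
  ENNReal.ofReal (Real.exp (σ.logDensityS x))

/-- The logarithm of the Gaussian conditional density of `U` given `(Y, H)`. -/
def logDensityYH (covZ : Matrix (Fin N) (Fin N) ℝ)
    (x : (Fin M → ℝ) × (Fin N → ℝ) × Matrix (Fin N) (Fin M) ℝ) : ℝ :=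
  gaussianLog (σ.errCov covZ x.2.2) (x.1 - σ.gain covZ x.2.2 *ᵥ x.2.1)

/-- The Gaussian density of `Y` given `H`. -/
def densityYH (covZ : Matrix (Fin N) (Fin N) ℝ)
    (x : (Fin N → ℝ) × Matrix (Fin N) (Fin M) ℝ) : ℝ≥0∞ :=
  ENNReal.ofReal (Real.exp (gaussianLog (σ.covY covZ x.2) x.1))

/-- The conditional density of `Y` given `(S, U, H)`. -/
def channelDensity (covZ : Matrix (Fin N) (Fin N) ℝ)
    (x : (Fin M → ℝ) × (Fin M → ℝ) × (Fin N → ℝ) × Matrix (Fin N) (Fin M) ℝ) : ℝ≥0∞ :=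
  ENNReal.ofReal (Real.exp (gaussianLog covZ
    (x.2.2.1 - x.2.2.2 *ᵥ (x.2.1 - σ.F *ᵥ x.1 + x.1))))

/-- The rate of the jointly Gaussian assignments. -/
def gaussianRate (ν : Measure (Matrix (Fin N) (Fin M) ℝ)) (covZ : Matrix (Fin N) (Fin N) ℝ) : ℝ :=
  1 / 2 * (Real.log ((2 * Real.pi) • σ.condCov).det -
    ∫ h, Real.log ((2 * Real.pi) • σ.errCov covZ h).det ∂ν)

theorem measurable_logDensityS : Measurable σ.logDensityS :=
  (measurable_gaussianLog _).comp
    (measurable_snd.sub ((measurable_mulVec _).comp measurable_fst))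

theorem measurable_densityS : Measurable σ.densityS :=
  σ.measurable_logDensityS.exp.ennreal_ofReal

theorem measurable_logDensityYH (covZ : Matrix (Fin N) (Fin N) ℝ) :
    Measurable (σ.logDensityYH covZ) := by
  have h : Measurable fun x : (Fin M → ℝ) × (Fin N → ℝ) × Matrix (Fin N) (Fin M) ℝ => x.2.2 :=
    measurable_snd.comp measurable_snd
  exact Measurable.gaussianLog ((σ.measurable_errCov covZ).comp h) (measurable_fst.sub
    (Measurable.matrixMulVec ((σ.measurable_gain covZ).comp h)
      (measurable_fst.comp measurable_snd)))

theorem measurable_densityYH (covZ : Matrix (Fin N) (Fin N) ℝ) :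
    Measurable (σ.densityYH covZ) :=
  (Measurable.gaussianLog ((σ.measurable_covY covZ).comp measurable_snd)
    measurable_fst).exp.ennreal_ofReal

theorem measurable_channelDensity (covZ : Matrix (Fin N) (Fin N) ℝ) :
    Measurable (σ.channelDensity covZ) := by
  refine ((measurable_gaussianLog covZ).comp (Measurable.sub ?_
    (Measurable.matrixMulVec ?_ (Measurable.add (Measurable.sub ?_ ?_) ?_)))).exp.ennreal_ofReal
  · exact measurable_fst.comp (measurable_snd.comp measurable_snd)
  · exact measurable_snd.comp (measurable_snd.comp measurable_snd)
  · exact measurable_fst.comp measurable_snd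
  · exact (measurable_mulVec _).comp measurable_fst
  · exact measurable_fst

theorem lintegral_densityS {σ : Setting M} (h : σ.covSUJoint.PosDef) (s : Fin M → ℝ) :
    ∫⁻ u, σ.densityS (s, u) = 1 := by
  rw [← lintegral_exp_gaussianLog (condCov_posDef h)]
  exact lintegral_sub_right_eq_self
    (fun u => ENNReal.ofReal (Real.exp (gaussianLog σ.condCov u))) (σ.gainS *ᵥ s)

end Setting

namespace LinearAssignment

variable {M N : ℕ} {σ : Setting M} {ν : Measure (Matrix (Fin N) (Fin M) ℝ)}
  {covZ : Matrix (Fin N) (Fin N) ℝ} {Ω : Type*} [MeasurableSpace Ω] {P : Measure Ω}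
  (a : LinearAssignment σ ν covZ P)

theorem map_S (h : σ.covSUJoint.PosDef) : P.map a.S = σ.lawS :=
  map_eq_withDensity_gaussian a.measurable_S a.gaussian_S a.mean_S a.cov_S
    (Setting.covS_posDef h)

theorem map_Z (h : covZ.PosDef) :
    P.map a.Z = volume.withDensity fun z => ENNReal.ofReal (Real.exp (gaussianLog covZ z)) :=
  map_eq_withDensity_gaussian a.measurable_Z a.gaussian_Z a.mean_Z a.cov_Z h

variable [IsProbabilityMeasure P]

theorem map_prodMk_HZ {α : Type*} [MeasurableSpace α] {f : (Fin M → ℝ) × (Fin M → ℝ) → α}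
    (hf : Measurable f) :
    P.map (fun ω => (f (a.S ω, a.X ω), a.H ω, a.Z ω)) =
      (P.map fun ω => f (a.S ω, a.X ω)).prod (ν.prod (P.map a.Z)) := by
  have hHZ := (indepFun_iff_map_prod_eq_prod_map_map a.measurable_H.aemeasurable
    a.measurable_Z.aemeasurable).1 a.indep_H_Z
  rw [a.law_H] at hHZ
  have hfm := hf.comp (a.measurable_S.prodMk a.measurable_X)
  have := (indepFun_iff_map_prod_eq_prod_map_map hfm.aemeasurable
    (a.measurable_H.prodMk a.measurable_Z).aemeasurable).1 (a.indep_SX_HZ.comp hf measurable_id)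
  rw [← hHZ]
  exact this

variable [IsProbabilityMeasure ν]

/-- Integration over the fading matrix can be performed last. -/
theorem lintegral_fading {g : Matrix (Fin N) (Fin M) ℝ × ((Fin M → ℝ) × (Fin M → ℝ)) ×
    (Fin N → ℝ) → ℝ≥0∞} (hg : Measurable g) :
    ∫⁻ ω, g (a.H ω, (a.S ω, a.X ω), a.Z ω) ∂P =
      ∫⁻ h, ∫⁻ ω, g (h, (a.S ω, a.X ω), a.Z ω) ∂P ∂ν := by
  have hSX := a.measurable_S.prodMk a.measurable_X
  have := Measure.isProbabilityMeasure_map (μ := P) hSX.aemeasurable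
  have := Measure.isProbabilityMeasure_map (μ := P) a.measurable_Z.aemeasurable
  have h1 := a.map_prodMk_HZ measurable_id
  have h2 := (indepFun_iff_map_prod_eq_prod_map_map hSX.aemeasurable
    a.measurable_Z.aemeasurable).1 a.indep_SX_Z
  simp only [id] at h1
  have hg1 : Measurable fun x : ((Fin M → ℝ) × (Fin M → ℝ)) × Matrix (Fin N) (Fin M) ℝ ×
      (Fin N → ℝ) => g (x.2.1, x.1, x.2.2) := by fun_prop
  calc ∫⁻ ω, g (a.H ω, (a.S ω, a.X ω), a.Z ω) ∂P
      = ∫⁻ x, g (x.2.1, x.1, x.2.2) ∂P.map (fun ω => ((a.S ω, a.X ω), a.H ω, a.Z ω)) :=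
        (lintegral_map hg1 (hSX.prodMk (a.measurable_H.prodMk a.measurable_Z))).symm
    _ = ∫⁻ y, ∫⁻ x, g (y.1, x, y.2) ∂(P.map fun ω => (a.S ω, a.X ω)) ∂ν.prod (P.map a.Z) := by
        rw [h1, lintegral_prod_symm' _ hg1]
    _ = ∫⁻ h, ∫⁻ z, ∫⁻ x, g (h, x, z) ∂(P.map fun ω => (a.S ω, a.X ω)) ∂(P.map a.Z) ∂ν :=
        lintegral_prod _ (Measurable.lintegral_prod_left' (f := fun x :
          ((Fin M → ℝ) × (Fin M → ℝ)) × Matrix (Fin N) (Fin M) ℝ × (Fin N → ℝ) =>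
            g (x.2.1, x.1, x.2.2)) hg1).aemeasurable
    _ = _ := by
        refine lintegral_congr fun h => ?_
        have hg2 : Measurable fun x => g (h, x) := by fun_prop
        rw [← lintegral_prod_symm' (fun x => g (h, x)) hg2, ← h2,
          lintegral_map hg2 (hSX.prodMk a.measurable_Z)]

/-- `(H, Z)` is independent of `(S, U)`, and for given `(s, u, h)` the output is `Z` translated by a
vector determined by them. Translation invariance of Lebesgue measure turns the density of `Z` into
`channelDensity`. Using the law `ν` of `H` as reference measure dispenses with any density for `H`.
-/
theorem map_SUYH (hZ : covZ.PosDef) (hSU : σ.covSUJoint.PosDef)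
    {q : (Fin M → ℝ) × (Fin M → ℝ) → ℝ≥0∞} (hq : Measurable q)
    (h : P.map (fun ω => (a.S ω, a.U ω)) = (σ.lawS.prod volume).withDensity q) :
    P.map (fun ω => (a.S ω, a.U ω, a.Y ω, a.H ω)) =
      (σ.lawS.prod (volume.prod (volume.prod ν))).withDensity
        fun x => q (x.1, x.2.1) * σ.channelDensity covZ x := by
  have : IsProbabilityMeasure σ.lawS := by
    rw [← a.map_S hSU]; exact Measure.isProbabilityMeasure_map a.measurable_S.aemeasurable
  have := Measure.isProbabilityMeasure_map (μ := P) a.measurable_Z.aemeasurable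
  have := Measure.isProbabilityMeasure_map (μ := P)
    (a.measurable_S.prodMk a.measurable_U).aemeasurable
  have hch := σ.measurable_channelDensity covZ
  have hdm : Measurable fun x : (Fin M → ℝ) × (Fin M → ℝ) × (Fin N → ℝ) ×
      Matrix (Fin N) (Fin M) ℝ => q (x.1, x.2.1) * σ.channelDensity covZ x := by fun_prop
  refine map_eq_withDensity_of_lintegral (a.measurable_S.prodMk
    (a.measurable_U.prodMk (a.measurable_Y.prodMk a.measurable_H))) hdm fun g hg => ?_
  have hf : Measurable fun x : (Fin M → ℝ) × (Fin M → ℝ) => (x.1, σ.F *ᵥ x.1 + x.2) :=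
    measurable_fst.prodMk (((measurable_mulVec σ.F).comp measurable_fst).add measurable_snd)
  have hlaw := a.map_prodMk_HZ hf
  -- `T (s, u)` recovers `X + S` from `(S, U)`, because `X = U - F S`. This is why the channel
  -- kernel does not depend on the choice of `X`.
  set T : (Fin M → ℝ) × (Fin M → ℝ) → Fin M → ℝ := fun x => x.2 - σ.F *ᵥ x.1 + x.1 with hT
  have hTm : Measurable T := (measurable_snd.sub
    ((measurable_mulVec σ.F).comp measurable_fst)).add measurable_fst
  have hGm := (measurable_gaussianLog covZ).exp.ennreal_ofReal
  have hg1 : Measurable fun x : ((Fin M → ℝ) × (Fin M → ℝ)) × Matrix (Fin N) (Fin M) ℝ ×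
      (Fin N → ℝ) => g (x.1.1, x.1.2, x.2.2 + x.2.1 *ᵥ T x.1, x.2.1) := by
    refine hg.comp (measurable_fst.fst.prodMk (measurable_fst.snd.prodMk
      (Measurable.prodMk ?_ measurable_snd.fst)))
    exact measurable_snd.snd.add
      (Measurable.matrixMulVec measurable_snd.fst (hTm.comp measurable_fst))
  calc ∫⁻ ω, g (a.S ω, a.U ω, a.Y ω, a.H ω) ∂P
      = ∫⁻ ω, (fun x : ((Fin M → ℝ) × (Fin M → ℝ)) × Matrix (Fin N) (Fin M) ℝ × (Fin N → ℝ) =>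
          g (x.1.1, x.1.2, x.2.2 + x.2.1 *ᵥ T x.1, x.2.1))
            ((a.S ω, a.U ω), a.H ω, a.Z ω) ∂P := by
        refine lintegral_congr fun ω => ?_
        simp only [hT, U, Y, add_sub_cancel_left, add_comm (a.Z ω)]
    _ = ∫⁻ x, ∫⁻ h, ∫⁻ z, g (x.1, x.2, z + h *ᵥ T x, h) ∂(P.map a.Z) ∂ν
          ∂(P.map fun ω => (a.S ω, a.U ω)) := by
        rw [← lintegral_map hg1 ((a.measurable_S.prodMk a.measurable_U).prodMk
          (a.measurable_H.prodMk a.measurable_Z))]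
        refine (congrArg (fun m => lintegral m _) hlaw).trans ?_
        rw [lintegral_prod _ hg1.aemeasurable]
        refine lintegral_congr fun x => ?_
        exact lintegral_prod (fun y : Matrix (Fin N) (Fin M) ℝ × (Fin N → ℝ) =>
          g (x.1, x.2, y.2 + y.1 *ᵥ T x, y.1)) (hg1.comp measurable_prodMk_left).aemeasurable
    _ = ∫⁻ x, ∫⁻ h, ∫⁻ y, σ.channelDensity covZ (x.1, x.2, y, h) * g (x.1, x.2, y, h)
          ∂volume ∂ν ∂(P.map fun ω => (a.S ω, a.U ω)) := by
        refine lintegral_congr fun x => lintegral_congr fun h => ?_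
        rw [a.map_Z hZ, lintegral_withDensity_eq_lintegral_mul _ hGm
          (g := fun z => g (x.1, x.2, z + h *ᵥ T x, h))
          (hg1.comp (measurable_const.prodMk (measurable_const.prodMk measurable_id))),
          ← lintegral_add_right_eq_self (fun y => σ.channelDensity covZ (x.1, x.2, y, h) *
            g (x.1, x.2, y, h)) (h *ᵥ T x)]
        simp [Setting.channelDensity, hT]
    _ = _ := by
        rw [h]
        exact lintegral_withDensity_prod_prod hq hch hg

end LinearAssignment

/-! ### Means of the Gaussian log-densities, and Bayes' rule. -/

theorem lintegral_prod_withDensity {α β : Type*} [MeasurableSpace α] [MeasurableSpace β]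
    {μ : Measure α} {ρ : Measure β} [SFinite μ] [SFinite ρ] {f : α → ℝ≥0∞} {Q g : α × β → ℝ≥0∞}
    (hf : Measurable f) (hQ : Measurable Q) (hg : Measurable g) :
    ∫⁻ x, Q x * g x ∂(μ.withDensity f).prod ρ =
      ∫⁻ y, ∫⁻ u, f y * Q (y, u) * g (y, u) ∂ρ ∂μ := by
  have hQg : Measurable fun x => Q x * g x := hQ.mul hg
  rw [lintegral_prod _ hQg.aemeasurable,
    lintegral_withDensity_eq_lintegral_mul _ hf hQg.lintegral_prod_right']
  refine lintegral_congr fun y => ?_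
  simp only [Pi.mul_apply, mul_assoc]
  exact (lintegral_const_mul _ (hQg.comp measurable_prodMk_left)).symm

/-- `V` need not be Gaussian: its quadratic form has mean `tr (C⁻¹ C) = n`, which involves only
second moments. -/
theorem integral_gaussianLog {Ω : Type*} [MeasurableSpace Ω] {P : Measure Ω}
    [IsProbabilityMeasure P] {n : ℕ} {V : Ω → Fin n → ℝ} {C : Matrix (Fin n) (Fin n) ℝ}
    (hV : ∀ i, MemLp (fun ω => V ω i) 2 P) (h0 : ∀ i, ∫ ω, V ω i ∂P = 0)
    (hcov : crossCov P V V = C) (hC : C.PosDef) :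
    Integrable (fun ω => gaussianLog C (V ω)) P ∧
      ∫ ω, gaussianLog C (V ω) ∂P = -(1 / 2) * (Real.log ((2 * Real.pi) • C).det + n) := by
  obtain ⟨h1, h2⟩ := integral_dotProduct_mulVec C⁻¹ hV h0
  rw [hcov, nonsing_inv_mul _ ((isUnit_iff_isUnit_det _).1 hC.isUnit), trace_one,
    Fintype.card_fin] at h2
  unfold gaussianLog
  refine ⟨((integrable_const _).add h1).const_mul _, ?_⟩
  rw [integral_const_mul, integral_add (integrable_const _) h1, h2]
  simp

theorem Measurable.quadForm {Ω : Type*} [MeasurableSpace Ω] {n : ℕ}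
    {C : Ω → Matrix (Fin n) (Fin n) ℝ} {v : Ω → Fin n → ℝ} (hC : Measurable C)
    (hv : Measurable v) : Measurable fun ω => v ω ⬝ᵥ (C ω)⁻¹ *ᵥ v ω := by
  have h2 := Measurable.matrixMulVec (Measurable.matrixInv hC) hv
  simp only [dotProduct]
  fun_prop

theorem quadForm_nonneg {n : ℕ} {C : Matrix (Fin n) (Fin n) ℝ} (hC : C.PosDef)
    (x : Fin n → ℝ) : 0 ≤ x ⬝ᵥ C⁻¹ *ᵥ x := by
  simpa using hC.posSemidef.inv.dotProduct_mulVec_nonneg x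

namespace LinearAssignment

variable {M N : ℕ} {σ : Setting M} {ν : Measure (Matrix (Fin N) (Fin M) ℝ)}
  {covZ : Matrix (Fin N) (Fin N) ℝ} {Ω : Type*} [MeasurableSpace Ω] {P : Measure Ω}
  (a : LinearAssignment σ ν covZ P)

theorem memLp_sub_mulVec [IsFiniteMeasure P] {k : ℕ} (K : Matrix (Fin M) (Fin k) ℝ) {W : Ω → Fin k → ℝ}
    (hW : ∀ i, MemLp (fun ω => W ω i) 2 P) (i : Fin M) :
    MemLp (fun ω => (a.U ω - K *ᵥ W ω) i) 2 P :=
  (a.memLp_U i).sub (memLp_mulVec K hW i)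

theorem integral_comp_H {f : Matrix (Fin N) (Fin M) ℝ → ℝ} (hf : Integrable f ν) :
    Integrable (fun ω => f (a.H ω)) P ∧ ∫ ω, f (a.H ω) ∂P = ∫ h, f h ∂ν := by
  rw [← a.law_H] at hf
  refine ⟨(integrable_map_measure hf.aestronglyMeasurable a.measurable_H.aemeasurable).1 hf, ?_⟩
  rw [← integral_map a.measurable_H.aemeasurable hf.aestronglyMeasurable, a.law_H]

theorem hasGaussianLaw_SU {a : LinearAssignment σ ν covZ P} (hg : a.IsJointlyGaussian) :
    HasGaussianLaw (fun ω => (a.S ω, a.U ω)) P :=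
  HasGaussianLaw.map_fun hg ((ContinuousLinearMap.fst ℝ _ _).prod
    ((LinearMap.toContinuousLinearMap σ.F.mulVecLin).comp (ContinuousLinearMap.fst ℝ _ _) +
      ContinuousLinearMap.snd ℝ _ _))

/-- Each `H i j` is independent of `(X + S) j`, so the square of their product is integrable
although neither factor need be bounded. -/
theorem memLp_Y
    (hH : Integrable (fun h : Matrix (Fin N) (Fin M) ℝ => ∑ i, ∑ j, h i j ^ 2) ν) (i : Fin N) :
    MemLp (fun ω => a.Y ω i) 2 P := by
  have hHij : ∀ j, Integrable (fun ω => a.H ω i j ^ 2) P := fun j => by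
    refine (a.integral_comp_H hH).1.mono'
      ((Measurable.entry a.measurable_H i j).pow_const 2).aestronglyMeasurable
      (ae_of_all _ fun ω => ?_)
    rw [Real.norm_of_nonneg (sq_nonneg _)]
    calc a.H ω i j ^ 2 ≤ ∑ j, a.H ω i j ^ 2 :=
          Finset.single_le_sum (f := fun j => a.H ω i j ^ 2) (fun _ _ => sq_nonneg _)
            (Finset.mem_univ j)
      _ ≤ ∑ i, ∑ j, a.H ω i j ^ 2 :=
          Finset.single_le_sum (f := fun i => ∑ j, a.H ω i j ^ 2)
            (fun _ _ => Finset.sum_nonneg fun _ _ => sq_nonneg _) (Finset.mem_univ i)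
  have hprod : ∀ j, MemLp (fun ω => a.H ω i j * (a.X ω + a.S ω) j) 2 P := fun j => by
    have hT : Measurable fun ω => (a.X ω + a.S ω) j :=
      (measurable_pi_apply j).comp (a.measurable_X.add a.measurable_S)
    refine (memLp_two_iff_integrable_sq
      ((Measurable.entry a.measurable_H i j).mul hT).aestronglyMeasurable).2 ?_
    have hind : IndepFun (fun ω => a.H ω i j ^ 2) (fun ω => (a.X ω + a.S ω) j ^ 2) P := by
      refine (a.indep_SX_HZ.comp (φ := fun x => (x.2 + x.1) j ^ 2) (ψ := fun x => x.1 i j ^ 2)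
        ?_ ?_).symm
      · exact ((measurable_pi_apply j).comp (measurable_snd.add measurable_fst)).pow_const 2
      · exact (Measurable.entry measurable_fst i j).pow_const 2
    refine (hind.integrable_mul (hHij j) (a.memLp_sum j).integrable_sq).congr
      (ae_of_all _ fun ω => ?_)
    simp only [Pi.mul_apply, mul_pow]
  exact (memLp_finsetSum Finset.univ (f := fun j ω => a.H ω i j * (a.X ω + a.S ω) j)
    fun j _ => hprod j).add (a.memLp_Z i)

/-- For fixed `h` the pair is a linear image of `(S, X, Z)`. With random `H` the output `Y` need not
be Gaussian, hence the passage through `outputAt`. -/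
theorem hasGaussianLaw_outputAt_U {a : LinearAssignment σ ν covZ P} (hg : a.IsJointlyGaussian) (h : Matrix (Fin N) (Fin M) ℝ) :
    HasGaussianLaw (fun ω => (a.outputAt h ω, a.U ω)) P := by
  have h1 : HasGaussianLaw (fun ω => ((a.S ω, a.X ω), a.Z ω)) P :=
    IndepFun.hasGaussianLaw hg a.gaussian_Z a.indep_SX_Z
  let s : ((Fin M → ℝ) × (Fin M → ℝ)) × (Fin N → ℝ) →L[ℝ] (Fin M → ℝ) :=
    (ContinuousLinearMap.fst ℝ _ _).comp (ContinuousLinearMap.fst ℝ _ _)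
  let x : ((Fin M → ℝ) × (Fin M → ℝ)) × (Fin N → ℝ) →L[ℝ] (Fin M → ℝ) :=
    (ContinuousLinearMap.snd ℝ _ _).comp (ContinuousLinearMap.fst ℝ _ _)
  exact h1.map_fun (((LinearMap.toContinuousLinearMap h.mulVecLin).comp (x + s) +
    ContinuousLinearMap.snd ℝ _ _).prod
      ((LinearMap.toContinuousLinearMap σ.F.mulVecLin).comp s + x))

variable [IsProbabilityMeasure P]

theorem cov_US : crossCov P a.U a.S = σ.covSUᵀ := by rw [← crossCov_transpose, a.cov_SU]

theorem gainS_mul_cov (hSU : σ.covSUJoint.PosDef) :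
    crossCov P a.U a.S = σ.gainS * crossCov P a.S a.S := by
  rw [a.cov_US, a.cov_S, Setting.gainS, Matrix.mul_assoc, nonsing_inv_mul _
    ((isUnit_iff_isUnit_det _).1 (Setting.covS_posDef hSU).isUnit), Matrix.mul_one]

theorem cov_U_sub_gainS : crossCov P a.U a.U - σ.gainS * crossCov P a.S a.U = σ.condCov := by
  rw [a.cov_U, a.cov_SU]
  rfl

theorem mean_sub_mulVec {k : ℕ} (K : Matrix (Fin M) (Fin k) ℝ) {W : Ω → Fin k → ℝ}
    (hW : ∀ i, MemLp (fun ω => W ω i) 2 P) (h0 : ∀ i, ∫ ω, W ω i ∂P = 0) (i : Fin M) :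
    ∫ ω, (a.U ω - K *ᵥ W ω) i ∂P = 0 := by
  have h1 := integral_mulVec_eq_zero K (fun i => (hW i).integrable one_le_two) h0 i
  have : ∫ ω, (a.U ω - K *ᵥ W ω) i ∂P = ∫ ω, a.U ω i ∂P - ∫ ω, (K *ᵥ W ω) i ∂P :=
    integral_sub ((a.memLp_U i).integrable one_le_two)
      ((memLp_mulVec K hW i).integrable one_le_two)
  rw [this, h1, a.mean_U, sub_zero]

theorem integral_logDensityS (hSU : σ.covSUJoint.PosDef) :
    Integrable (fun ω => σ.logDensityS (a.S ω, a.U ω)) P ∧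
      ∫ ω, σ.logDensityS (a.S ω, a.U ω) ∂P =
        -(1 / 2) * (Real.log ((2 * Real.pi) • σ.condCov).det + M) := by
  refine integral_gaussianLog (a.memLp_sub_mulVec _ a.memLp_S)
    (a.mean_sub_mulVec _ a.memLp_S a.mean_S) ?_ (Setting.condCov_posDef hSU)
  rw [crossCov_sub_mulVec_self a.memLp_U a.memLp_S (a.gainS_mul_cov hSU), a.cov_U_sub_gainS]

theorem map_SU_of_gaussian {a : LinearAssignment σ ν covZ P} (hSU : σ.covSUJoint.PosDef) (hg : a.IsJointlyGaussian) :
    P.map (fun ω => (a.S ω, a.U ω)) = (σ.lawS.prod volume).withDensity σ.densityS := by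
  rw [← a.map_S hSU]
  exact map_prodMk_eq_withDensity_gaussian a.measurable_S a.measurable_U (hasGaussianLaw_SU hg)
    a.mean_U a.mean_S (Setting.condCov_posDef hSU) (a.gainS_mul_cov hSU) a.cov_U_sub_gainS

theorem isProbabilityMeasure_lawS (a : LinearAssignment σ ν covZ P) (hSU : σ.covSUJoint.PosDef) :
    IsProbabilityMeasure σ.lawS := by
  rw [← a.map_S hSU]
  exact Measure.isProbabilityMeasure_map a.measurable_S.aemeasurable

variable [IsProbabilityMeasure ν]

/-- The squared Mahalanobis norm of the estimation error of `U` from `(Y, H)` has mean `M`. -/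
theorem integral_quadForm_error (hZ : covZ.PosDef) (hSU : σ.covSUJoint.PosDef) :
    Integrable (fun ω => (a.U ω - σ.gain covZ (a.H ω) *ᵥ a.Y ω) ⬝ᵥ
        (σ.errCov covZ (a.H ω))⁻¹ *ᵥ (a.U ω - σ.gain covZ (a.H ω) *ᵥ a.Y ω)) P ∧
      ∫ ω, (a.U ω - σ.gain covZ (a.H ω) *ᵥ a.Y ω) ⬝ᵥ
        (σ.errCov covZ (a.H ω))⁻¹ *ᵥ (a.U ω - σ.gain covZ (a.H ω) *ᵥ a.Y ω) ∂P = M := by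
  set f : Matrix (Fin N) (Fin M) ℝ × ((Fin M → ℝ) × (Fin M → ℝ)) × (Fin N → ℝ) → Fin M → ℝ :=
    fun x => σ.F *ᵥ x.2.1.1 + x.2.1.2 -
      σ.gain covZ x.1 *ᵥ (x.1 *ᵥ (x.2.1.2 + x.2.1.1) + x.2.2) with hf
  have hfm : Measurable f := by
    refine Measurable.sub (Measurable.add ?_ measurable_snd.fst.snd) (Measurable.matrixMulVec
      ((σ.measurable_gain covZ).comp measurable_fst) (Measurable.add (Measurable.matrixMulVec
        measurable_fst (measurable_snd.fst.snd.add measurable_snd.fst.fst)) measurable_snd.snd))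
    exact (measurable_mulVec σ.F).comp measurable_snd.fst.fst
  have hq : Measurable fun x => f x ⬝ᵥ (σ.errCov covZ x.1)⁻¹ *ᵥ f x :=
    Measurable.quadForm ((σ.measurable_errCov covZ).comp measurable_fst) hfm
  have hfω : ∀ ω, f (a.H ω, (a.S ω, a.X ω), a.Z ω) =
      a.U ω - σ.gain covZ (a.H ω) *ᵥ a.Y ω := fun ω => by simp only [hf, U, Y]
  have hfh : ∀ h ω, f (h, (a.S ω, a.X ω), a.Z ω) = a.U ω - σ.gain covZ h *ᵥ a.outputAt h ω :=
    fun h ω => by simp only [hf, U, outputAt]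
  have hqω : Measurable fun ω => (a.U ω - σ.gain covZ (a.H ω) *ᵥ a.Y ω) ⬝ᵥ
      (σ.errCov covZ (a.H ω))⁻¹ *ᵥ (a.U ω - σ.gain covZ (a.H ω) *ᵥ a.Y ω) :=
    Measurable.quadForm ((σ.measurable_errCov covZ).comp a.measurable_H) (a.measurable_U.sub
      (Measurable.matrixMulVec ((σ.measurable_gain covZ).comp a.measurable_H) a.measurable_Y))
  have hnnω : ∀ ω, 0 ≤ (a.U ω - σ.gain covZ (a.H ω) *ᵥ a.Y ω) ⬝ᵥ
      (σ.errCov covZ (a.H ω))⁻¹ *ᵥ (a.U ω - σ.gain covZ (a.H ω) *ᵥ a.Y ω) := fun ω =>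
    quadForm_nonneg (a.errCov_posDef hZ hSU (a.H ω)) _
  -- Working with nonnegative integrals lets the fading matrix be integrated last without prior
  -- integrability. For each fixed `h` the inner mean is `tr (C⁻¹ C) = M`, with `C` the error
  -- covariance at `h`.
  have key : ∫⁻ ω, ENNReal.ofReal ((a.U ω - σ.gain covZ (a.H ω) *ᵥ a.Y ω) ⬝ᵥ
      (σ.errCov covZ (a.H ω))⁻¹ *ᵥ (a.U ω - σ.gain covZ (a.H ω) *ᵥ a.Y ω)) ∂P =
      ENNReal.ofReal M := by
    have hfad := a.lintegral_fading hq.ennreal_ofReal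
    simp only [hfω] at hfad
    rw [hfad]
    have : ∀ h, ∫⁻ ω, ENNReal.ofReal (f (h, (a.S ω, a.X ω), a.Z ω) ⬝ᵥ
        (σ.errCov covZ h)⁻¹ *ᵥ f (h, (a.S ω, a.X ω), a.Z ω)) ∂P = ENNReal.ofReal M := by
      intro h
      obtain ⟨h1, h2⟩ := integral_dotProduct_mulVec (σ.errCov covZ h)⁻¹
        (a.memLp_sub_mulVec (σ.gain covZ h) (a.memLp_outputAt h))
        (a.mean_sub_mulVec _ (a.memLp_outputAt h) (a.mean_outputAt h))
      rw [crossCov_sub_mulVec_self a.memLp_U (a.memLp_outputAt h)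
        (a.gain_mul_cov_outputAt hZ h), a.cov_U_sub_gain h, nonsing_inv_mul _
        ((isUnit_iff_isUnit_det _).1 (a.errCov_posDef hZ hSU h).isUnit), trace_one,
        Fintype.card_fin] at h2
      rw [← h2, ofReal_integral_eq_lintegral_ofReal h1 (ae_of_all _ fun ω =>
        quadForm_nonneg (a.errCov_posDef hZ hSU h) _)]
      simp only [hfh]
    simp only [this, lintegral_const, measure_univ, mul_one]
  refine ⟨integrable_of_lintegral_ofReal_ne_top hqω (key ▸ ENNReal.ofReal_ne_top) hnnω, ?_⟩
  rw [integral_eq_lintegral_of_nonneg_ae (ae_of_all _ hnnω) hqω.aestronglyMeasurable, key,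
    ENNReal.toReal_ofReal (Nat.cast_nonneg _)]

theorem integral_logDensityYH (hZ : covZ.PosDef) (hSU : σ.covSUJoint.PosDef)
    (hdet : Integrable (fun h => Real.log ((2 * Real.pi) • σ.errCov covZ h).det) ν) :
    Integrable (fun ω => σ.logDensityYH covZ (a.U ω, a.Y ω, a.H ω)) P ∧
      ∫ ω, σ.logDensityYH covZ (a.U ω, a.Y ω, a.H ω) ∂P =
        -(1 / 2) * (∫ h, Real.log ((2 * Real.pi) • σ.errCov covZ h).det ∂ν + M) := by
  obtain ⟨h1, h2⟩ := a.integral_quadForm_error hZ hSU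
  obtain ⟨h3, h4⟩ := a.integral_comp_H hdet
  unfold Setting.logDensityYH gaussianLog
  refine ⟨(h3.add h1).const_mul _, ?_⟩
  rw [integral_const_mul, integral_add h3 h1, h2, h4]

/-- The upper bound in Gibbs' inequality takes the same value for every assignment with the setting;
the two dimension terms `M` cancel. -/
theorem integral_logDensity_sub (hZ : covZ.PosDef) (hSU : σ.covSUJoint.PosDef)
    (hdet : Integrable (fun h => Real.log ((2 * Real.pi) • σ.errCov covZ h).det) ν) :
    Integrable (fun ω => σ.logDensityYH covZ (a.U ω, a.Y ω, a.H ω) -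
        σ.logDensityS (a.S ω, a.U ω)) P ∧
      ∫ ω, (σ.logDensityYH covZ (a.U ω, a.Y ω, a.H ω) - σ.logDensityS (a.S ω, a.U ω)) ∂P =
        σ.gaussianRate ν covZ := by
  obtain ⟨h1, h2⟩ := a.integral_logDensityS hSU
  obtain ⟨h3, h4⟩ := a.integral_logDensityYH hZ hSU hdet
  refine ⟨h3.sub h1, ?_⟩
  rw [integral_sub h3 h1, h2, h4, Setting.gaussianRate]
  ring

/-- For each value of `H` the pair `(Y, U)` is Gaussian, and its density splits into that of `Y` and
that of `U` given `Y`. -/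
theorem map_UYH_of_gaussian {a : LinearAssignment σ ν covZ P} (hZ : covZ.PosDef) (hSU : σ.covSUJoint.PosDef)
    (hg : a.IsJointlyGaussian) :
    P.map (fun ω => (a.U ω, a.Y ω, a.H ω)) = (volume.prod (volume.prod ν)).withDensity
      fun x => σ.densityYH covZ x.2 * ENNReal.ofReal (Real.exp (σ.logDensityYH covZ x)) := by
  have hd := σ.measurable_densityYH covZ
  have hl := (σ.measurable_logDensityYH covZ).exp.ennreal_ofReal
  have hdm : Measurable fun x : (Fin M → ℝ) × (Fin N → ℝ) × Matrix (Fin N) (Fin M) ℝ =>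
      σ.densityYH covZ x.2 * ENNReal.ofReal (Real.exp (σ.logDensityYH covZ x)) := by fun_prop
  refine map_eq_withDensity_of_lintegral
    (a.measurable_U.prodMk (a.measurable_Y.prodMk a.measurable_H)) hdm fun g hgm => ?_
  have hgf : Measurable fun x : Matrix (Fin N) (Fin M) ℝ × ((Fin M → ℝ) × (Fin M → ℝ)) ×
      (Fin N → ℝ) => g (σ.F *ᵥ x.2.1.1 + x.2.1.2, x.1 *ᵥ (x.2.1.2 + x.2.1.1) + x.2.2, x.1) := by
    refine hgm.comp (Measurable.prodMk (Measurable.add ?_ measurable_snd.fst.snd)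
      (Measurable.prodMk (Measurable.add (Measurable.matrixMulVec measurable_fst
        (measurable_snd.fst.snd.add measurable_snd.fst.fst)) measurable_snd.snd) measurable_fst))
    exact (measurable_mulVec σ.F).comp measurable_snd.fst.fst
  have hinner : Measurable fun x : (Fin N → ℝ) × Matrix (Fin N) (Fin M) ℝ =>
      ∫⁻ u, σ.densityYH covZ x * ENNReal.ofReal (Real.exp (σ.logDensityYH covZ (u, x))) *
        g (u, x) := by
    refine Measurable.lintegral_prod_left' (f := fun x : (Fin M → ℝ) × (Fin N → ℝ) ×
      Matrix (Fin N) (Fin M) ℝ => σ.densityYH covZ x.2 *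
        ENNReal.ofReal (Real.exp (σ.logDensityYH covZ x)) * g x) ?_
    fun_prop
  have hfad : ∫⁻ ω, g (a.U ω, a.Y ω, a.H ω) ∂P =
      ∫⁻ h, ∫⁻ ω, g (a.U ω, a.outputAt h ω, h) ∂P ∂ν := by
    simpa only [U, Y, outputAt] using a.lintegral_fading hgf
  rw [lintegral_prod_symm' _ (by fun_prop), lintegral_prod_symm' _ hinner, hfad]
  refine lintegral_congr fun h => ?_
  have hlaw := map_prodMk_eq_withDensity_gaussian (a.measurable_outputAt h) a.measurable_U
    (hasGaussianLaw_outputAt_U hg h) a.mean_U (a.mean_outputAt h) (a.errCov_posDef hZ hSU h)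
    (a.gain_mul_cov_outputAt hZ h) (a.cov_U_sub_gain h)
  have hgY : HasGaussianLaw (a.outputAt h) P := (hasGaussianLaw_outputAt_U hg h).fst
  have hlawY := map_eq_withDensity_gaussian (a.measurable_outputAt h)
    hgY (a.mean_outputAt h) (a.cov_outputAt h)
    (a.covY_posDef hZ h)
  have hx : Measurable fun x : (Fin N → ℝ) × (Fin M → ℝ) => (x.2, x.1, h) := by fun_prop
  have hQ : Measurable fun x : (Fin N → ℝ) × (Fin M → ℝ) =>
      ENNReal.ofReal (Real.exp (gaussianLog (σ.errCov covZ h) (x.2 - σ.gain covZ h *ᵥ x.1))) :=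
    ((measurable_gaussianLog _).comp
      (measurable_snd.sub ((measurable_mulVec _).comp measurable_fst))).exp.ennreal_ofReal
  have hgx : Measurable fun x : (Fin N → ℝ) × (Fin M → ℝ) => g (x.2, x.1, h) := hgm.comp hx
  have h1 := lintegral_comp_eq_of_map_eq ((a.measurable_outputAt h).prodMk a.measurable_U) hQ hlaw
    hgx
  rw [hlawY, lintegral_prod_withDensity (measurable_gaussianLog _).exp.ennreal_ofReal hQ hgx] at h1
  simpa only [Setting.densityYH, Setting.logDensityYH] using h1

theorem map_UYH (hZ : covZ.PosDef) (hSU : σ.covSUJoint.PosDef)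
    {q : (Fin M → ℝ) × (Fin M → ℝ) → ℝ≥0∞} (hq : Measurable q)
    (h : P.map (fun ω => (a.S ω, a.U ω)) = (σ.lawS.prod volume).withDensity q) :
    P.map (fun ω => (a.U ω, a.Y ω, a.H ω)) = (volume.prod (volume.prod ν)).withDensity
      (outputDensity σ.lawS q (σ.channelDensity covZ)) := by
  have := a.isProbabilityMeasure_lawS hSU
  exact map_output_eq_withDensity (W := fun ω => (a.Y ω, a.H ω)) a.measurable_S a.measurable_U
    (a.measurable_Y.prodMk a.measurable_H) hq (σ.measurable_channelDensity covZ)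
    (a.map_SUYH hZ hSU hq h)

/-- Bayes' rule for the Gaussian densities. -/
theorem outputDensity_logDensityS_ae_eq (hZ : covZ.PosDef) (hSU : σ.covSUJoint.PosDef)
    (hg : a.IsJointlyGaussian) :
    outputDensity σ.lawS σ.densityS (σ.channelDensity covZ) =ᵐ[volume.prod (volume.prod ν)]
      fun x => σ.densityYH covZ x.2 * ENNReal.ofReal (Real.exp (σ.logDensityYH covZ x)) := by
  have := a.isProbabilityMeasure_lawS hSU
  have hq := σ.measurable_densityS
  have hd := σ.measurable_densityYH covZ
  have hl := (σ.measurable_logDensityYH covZ).exp.ennreal_ofReal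
  have hj := measurable_outputDensity (π := σ.lawS) hq (σ.measurable_channelDensity covZ)
  have h1 := a.map_UYH hZ hSU hq (map_SU_of_gaussian hSU hg)
  have h2 := lintegral_density_eq_one
    (a.measurable_U.prodMk (a.measurable_Y.prodMk a.measurable_H)) hj h1
  -- Both sides are densities of the law of `(U, Y, H)`: one obtained through the channel, the other
  -- by conditioning on `(Y, H)`. Densities of a finite measure agree almost everywhere.
  refine (withDensity_eq_iff hj.aemeasurable (by fun_prop) ?_).1
    (h1.symm.trans (map_UYH_of_gaussian hZ hSU hg))
  rw [h2]
  exact ENNReal.one_ne_top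

end LinearAssignment

/-! ### Finiteness, upper bound and exact value of the rate. -/

theorem integrable_gaussianLog {Ω : Type*} [MeasurableSpace Ω] {P : Measure Ω}
    [IsFiniteMeasure P] {n : ℕ} {V : Ω → Fin n → ℝ} (C : Matrix (Fin n) (Fin n) ℝ)
    (hV : ∀ i, MemLp (fun ω => V ω i) 2 P) : Integrable (fun ω => gaussianLog C (V ω)) P := by
  have : Integrable (fun ω => V ω ⬝ᵥ C⁻¹ *ᵥ V ω) P :=
    integrable_finsetSum Finset.univ (f := fun i ω => V ω i * (C⁻¹ *ᵥ V ω) i) fun i _ =>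
      (hV i).integrable_mul (memLp_mulVec C⁻¹ hV i)
  exact ((integrable_const _).add this).const_mul _

theorem gaussianLog_le {n : ℕ} {C : Matrix (Fin n) (Fin n) ℝ} (hC : C.PosDef) (x : Fin n → ℝ) :
    gaussianLog C x ≤ -(1 / 2) * Real.log ((2 * Real.pi) • C).det := by
  have := quadForm_nonneg hC x
  unfold gaussianLog
  linarith

namespace LinearAssignment

variable {M N : ℕ} {σ : Setting M} {ν : Measure (Matrix (Fin N) (Fin M) ℝ)}
  {covZ : Matrix (Fin N) (Fin N) ℝ} {Ω : Type*} [MeasurableSpace Ω] {P : Measure Ω}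

theorem rate_eq_coe_sub {a : LinearAssignment σ ν covZ P} (h1 : a.infoOutput ≠ ⊤)
    (h2 : a.infoInterference ≠ ⊤) :
    a.rate = ((a.infoOutput.toReal - a.infoInterference.toReal : ℝ) : EReal) := by
  rw [rate, EReal.coe_sub, EReal.coe_ennreal_toReal h1, EReal.coe_ennreal_toReal h2]

theorem rate_eq_bot {a : LinearAssignment σ ν covZ P} (h1 : a.infoOutput ≠ ⊤)
    (h2 : a.infoInterference = ⊤) : a.rate = ⊥ := by
  rw [rate, h2, ← EReal.coe_ennreal_toReal h1]
  rfl

variable [IsProbabilityMeasure P]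

theorem hasCondDensity_of_gaussian {a : LinearAssignment σ ν covZ P}
    (hSU : σ.covSUJoint.PosDef) (hg : a.IsJointlyGaussian) : HasCondDensity P a.U a.S := by
  refine ⟨fun s u => σ.densityS (s, u), σ.measurable_densityS, Setting.lintegral_densityS hSU, ?_⟩
  rw [map_SU_of_gaussian hSU hg, a.map_S hSU]
  rfl

theorem map_US (a : LinearAssignment σ ν covZ P) (hSU : σ.covSUJoint.PosDef)
    {q : (Fin M → ℝ) × (Fin M → ℝ) → ℝ≥0∞} (hq : Measurable q)
    (h : P.map (fun ω => (a.S ω, a.U ω)) = (σ.lawS.prod volume).withDensity q) :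
    P.map (fun ω => (a.U ω, a.S ω)) = (volume.prod σ.lawS).withDensity fun x => q x.swap := by
  have := a.isProbabilityMeasure_lawS hSU
  exact map_swap_eq_withDensity a.measurable_S a.measurable_U hq h

/-- The domination criterion holds with equality: take `r₁` the Gaussian density of covariance
`covU`, and `b` the difference of two Gaussian log-densities, integrable because the vectors are
square integrable. -/
theorem infoInterference_ne_top_of_gaussian {a : LinearAssignment σ ν covZ P}
    (hSU : σ.covSUJoint.PosDef) (hg : a.IsJointlyGaussian) : a.infoInterference ≠ ⊤ := by
  have := a.isProbabilityMeasure_lawS hSU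
  have hq := σ.measurable_densityS
  have hqs : Measurable fun x : (Fin M → ℝ) × (Fin M → ℝ) =>
      σ.densityS x.swap := hq.comp measurable_swap
  have hlog : Integrable
      (fun ω => σ.logDensityS (a.S ω, a.U ω) - gaussianLog σ.covU (a.U ω)) P :=
    (a.integral_logDensityS hSU).1.sub (integrable_gaussianLog σ.covU a.memLp_U)
  refine mutualInfo_ne_top_of_le a.measurable_U a.measurable_S hqs
    (a.map_US hSU hq (map_SU_of_gaussian hSU hg))
    (r₁ := fun u => ENNReal.ofReal (Real.exp (gaussianLog σ.covU u))) (r₂ := fun _ => 1)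
    (measurable_gaussianLog _).exp.ennreal_ofReal measurable_const
    (by simp [lintegral_exp_gaussianLog (Setting.covU_posDef hSU)]) (by simp) hlog
    (ae_of_all _ fun ω => ?_)
  rw [mul_one, ← ENNReal.ofReal_mul (Real.exp_pos _).le, ← Real.exp_add]
  simp only [sub_add_cancel, Prod.swap_prod_mk]
  exact le_rfl

theorem lintegral_exp_logDensityYH (a : LinearAssignment σ ν covZ P) (hZ : covZ.PosDef)
    (hSU : σ.covSUJoint.PosDef) (w : (Fin N → ℝ) × Matrix (Fin N) (Fin M) ℝ) :
    ∫⁻ u, ENNReal.ofReal (Real.exp (σ.logDensityYH covZ (u, w))) = 1 := by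
  rw [← lintegral_exp_gaussianLog (a.errCov_posDef hZ hSU w.2)]
  exact lintegral_sub_right_eq_self
    (fun u => ENNReal.ofReal (Real.exp (gaussianLog (σ.errCov covZ w.2) u)))
    (σ.gain covZ w.2 *ᵥ w.1)

variable [IsProbabilityMeasure ν]

/-- The channel density never exceeds the peak value of the noise density. -/
theorem outputDensity_channelDensity_le (hZ : covZ.PosDef)
    {q : (Fin M → ℝ) × (Fin M → ℝ) → ℝ≥0∞} (hq : Measurable q)
    (x : (Fin M → ℝ) × (Fin N → ℝ) × Matrix (Fin N) (Fin M) ℝ) :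
    outputDensity σ.lawS q (σ.channelDensity covZ) x ≤
      (∫⁻ s, q (s, x.1) ∂σ.lawS) *
        ENNReal.ofReal (Real.exp (-(1 / 2) * Real.log ((2 * Real.pi) • covZ).det)) := by
  have hqx : Measurable fun s => q (s, x.1) := hq.comp measurable_prodMk_right
  rw [← lintegral_mul_const _ hqx]
  refine lintegral_mono fun s => mul_le_mul_right ?_ _
  exact ENNReal.ofReal_le_ofReal (Real.exp_le_exp.2 (gaussianLog_le hZ _))

/-- In the domination criterion `r₁` is the density of `U` and `r₂` the noise density evaluated at
`y`. The exponent `b` is the logarithm of the noise peak minus the Gaussian logarithm at `Y`; it is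
integrable because `Y` is square integrable. -/
theorem infoOutput_ne_top (a : LinearAssignment σ ν covZ P)
    (hH : Integrable (fun h : Matrix (Fin N) (Fin M) ℝ => ∑ i, ∑ j, h i j ^ 2) ν)
    (hZ : covZ.PosDef) (hSU : σ.covSUJoint.PosDef)
    {q : (Fin M → ℝ) × (Fin M → ℝ) → ℝ≥0∞} (hq : Measurable q)
    (h : P.map (fun ω => (a.S ω, a.U ω)) = (σ.lawS.prod volume).withDensity q) :
    a.infoOutput ≠ ⊤ := by
  have := a.isProbabilityMeasure_lawS hSU
  have hr₁ : Measurable fun u => ∫⁻ s, q (s, u) ∂σ.lawS := hq.lintegral_prod_left'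
  have hU1 := lintegral_density_eq_one a.measurable_U hr₁
    (map_snd_eq_withDensity a.measurable_S a.measurable_U hq h)
  have hG := (measurable_gaussianLog covZ).exp.ennreal_ofReal
  have hr₂ : Measurable fun x : (Fin N → ℝ) × Matrix (Fin N) (Fin M) ℝ =>
      ENNReal.ofReal (Real.exp (gaussianLog covZ x.1)) := hG.comp measurable_fst
  have hY1 : ∫⁻ x : (Fin N → ℝ) × Matrix (Fin N) (Fin M) ℝ,
      ENNReal.ofReal (Real.exp (gaussianLog covZ x.1)) ∂volume.prod ν = 1 := by
    rw [lintegral_prod _ hr₂.aemeasurable]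
    simp [lintegral_exp_gaussianLog hZ]
  have hb := (integrable_const (-(1 / 2) * Real.log ((2 * Real.pi) • covZ).det) (μ := P)).sub
    (integrable_gaussianLog covZ (a.memLp_Y hH))
  refine mutualInfo_ne_top_of_le (W := fun ω => (a.Y ω, a.H ω)) a.measurable_U
    (a.measurable_Y.prodMk a.measurable_H)
    (measurable_outputDensity hq (σ.measurable_channelDensity covZ)) (a.map_UYH hZ hSU hq h)
    hr₁ hr₂ (by rw [hU1]; exact ENNReal.one_ne_top) (by rw [hY1]; exact ENNReal.one_ne_top) hb
    (ae_of_all _ fun ω => ?_)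
  refine (outputDensity_channelDensity_le hZ hq _).trans (le_of_eq ?_)
  rw [mul_comm (ENNReal.ofReal _) (lintegral _ _), mul_assoc,
    ← ENNReal.ofReal_mul (Real.exp_pos _).le, ← Real.exp_add]
  simp only [Pi.sub_apply, sub_add_cancel]

theorem rate_eq_integral (a : LinearAssignment σ ν covZ P) (hZ : covZ.PosDef)
    (hSU : σ.covSUJoint.PosDef)
    {q : (Fin M → ℝ) × (Fin M → ℝ) → ℝ≥0∞} (hq : Measurable q)
    (h : P.map (fun ω => (a.S ω, a.U ω)) = (σ.lawS.prod volume).withDensity q)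
    (h1 : a.infoOutput ≠ ⊤) (h2 : a.infoInterference ≠ ⊤) :
    a.rate = ((∫ ω, infoDensity volume (volume.prod ν)
        (outputDensity σ.lawS q (σ.channelDensity covZ)) (a.U ω, a.Y ω, a.H ω) ∂P -
      ∫ ω, infoDensity volume σ.lawS (fun x => q x.swap) (a.U ω, a.S ω) ∂P : ℝ) : EReal) := by
  have := a.isProbabilityMeasure_lawS hSU
  have hqs : Measurable fun x : (Fin M → ℝ) × (Fin M → ℝ) => q x.swap := hq.comp measurable_swap
  have e1 := toReal_mutualInfo (W := fun ω => (a.Y ω, a.H ω)) a.measurable_U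
    (a.measurable_Y.prodMk a.measurable_H)
    (measurable_outputDensity hq (σ.measurable_channelDensity covZ)) (a.map_UYH hZ hSU hq h)
  have e2 := toReal_mutualInfo a.measurable_U a.measurable_S hqs (a.map_US hSU hq h)
  rw [rate_eq_coe_sub h1 h2, ← e1, ← e2]
  rfl

theorem lintegral_densityYH (a : LinearAssignment σ ν covZ P) (hZ : covZ.PosDef) :
    ∫⁻ x, σ.densityYH covZ x ∂volume.prod ν = 1 := by
  rw [lintegral_prod_symm' _ (σ.measurable_densityYH covZ)]
  simp only [Setting.densityYH, lintegral_exp_gaussianLog (a.covY_posDef hZ _), lintegral_const,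
    measure_univ, mul_one]

/-- `hQm` involves only the Gaussian densities of the setting. It can thus be supplied by any
jointly Gaussian assignment while `a` itself is arbitrary. -/
theorem rate_le_gaussianRate (a : LinearAssignment σ ν covZ P) (hZ : covZ.PosDef)
    (hSU : σ.covSUJoint.PosDef)
    (hdet : Integrable (fun h => Real.log ((2 * Real.pi) • σ.errCov covZ h).det) ν)
    (hQm : outputDensity σ.lawS σ.densityS (σ.channelDensity covZ) =ᵐ[volume.prod (volume.prod ν)]
      fun x => σ.densityYH covZ x.2 * ENNReal.ofReal (Real.exp (σ.logDensityYH covZ x)))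
    {q : (Fin M → ℝ) × (Fin M → ℝ) → ℝ≥0∞} (hq : Measurable q)
    (hq1 : ∀ s, ∫⁻ u, q (s, u) = 1)
    (h : P.map (fun ω => (a.S ω, a.U ω)) = (σ.lawS.prod volume).withDensity q)
    (h1 : a.infoOutput ≠ ⊤) : a.rate ≤ (σ.gaussianRate ν covZ : ℝ) := by
  have := a.isProbabilityMeasure_lawS hSU
  by_cases h2 : a.infoInterference = ⊤
  · rw [rate_eq_bot h1 h2]
    exact bot_le
  have hqs : Measurable fun x : (Fin M → ℝ) × (Fin M → ℝ) => q x.swap := hq.comp measurable_swap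
  have hW := a.measurable_Y.prodMk a.measurable_H
  have hch := σ.measurable_channelDensity covZ
  obtain ⟨hL, hval⟩ := a.integral_logDensity_sub hZ hSU hdet
  have i1 := (mutualInfo_ne_top_iff (W := fun ω => (a.Y ω, a.H ω)) a.measurable_U hW
    (measurable_outputDensity hq hch) (a.map_UYH hZ hSU hq h)).1 h1
  have i2 := (mutualInfo_ne_top_iff a.measurable_U a.measurable_S hqs (a.map_US hSU hq h)).1 h2
  rw [a.rate_eq_integral hZ hSU hq h h1 h2, ← hval, EReal.coe_le_coe_iff]
  exact integral_infoDensity_sub_le (W := fun ω => (a.Y ω, a.H ω)) (α := volume)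
    (β := volume.prod ν) (Q' := σ.logDensityYH covZ) a.measurable_S a.measurable_U hW hq hch
    (a.map_SUYH hZ hSU hq h) h hq1 σ.measurable_logDensityS (σ.measurable_logDensityYH covZ)
    (σ.measurable_densityYH covZ) (a.lintegral_densityYH hZ).le hQm i1 i2 hL

theorem rate_eq_gaussianRate {a : LinearAssignment σ ν covZ P} (hg : a.IsJointlyGaussian)
    (hZ : covZ.PosDef) (hSU : σ.covSUJoint.PosDef)
    (hdet : Integrable (fun h => Real.log ((2 * Real.pi) • σ.errCov covZ h).det) ν)
    (h1 : a.infoOutput ≠ ⊤) : a.rate = (σ.gaussianRate ν covZ : ℝ) := by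
  have := a.isProbabilityMeasure_lawS hSU
  have h := map_SU_of_gaussian hSU hg
  have h2 := infoInterference_ne_top_of_gaussian hSU hg
  have hq := σ.measurable_densityS
  have hqs : Measurable fun x : (Fin M → ℝ) × (Fin M → ℝ) =>
      σ.densityS x.swap := hq.comp measurable_swap
  have hW := a.measurable_Y.prodMk a.measurable_H
  have hch := σ.measurable_channelDensity covZ
  have i1 := (mutualInfo_ne_top_iff (W := fun ω => (a.Y ω, a.H ω)) a.measurable_U hW
    (measurable_outputDensity hq hch) (a.map_UYH hZ hSU hq h)).1 h1
  have i2 := (mutualInfo_ne_top_iff a.measurable_U a.measurable_S hqs (a.map_US hSU hq h)).1 h2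
  rw [a.rate_eq_integral hZ hSU hq h h1 h2, ← integral_sub i1 i2,
    ← (a.integral_logDensity_sub hZ hSU hdet).2]
  congr 1
  exact integral_congr_ae (infoDensity_sub_ae_eq (W := fun ω => (a.Y ω, a.H ω)) (α := volume)
    (β := volume.prod ν) a.measurable_S a.measurable_U hW hq hch (fun _ => rfl)
    (σ.measurable_logDensityYH covZ) (σ.measurable_densityYH covZ) (a.map_SUYH hZ hSU hq h) h
    (Setting.lintegral_densityS hSU) (a.lintegral_exp_logDensityYH hZ hSU)
    (outputDensity_logDensityS_ae_eq a hZ hSU hg))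

end LinearAssignment

/-! ### Construction of a jointly Gaussian assignment. -/

section MultivariateGaussian

variable {Ω ι : Type*} [MeasurableSpace Ω] {P : Measure Ω} [Fintype ι] [DecidableEq ι]
  {G : Ω → EuclideanSpace ℝ ι} {C : Matrix ι ι ℝ}

theorem hasGaussianLaw_of_map_eq (h : P.map G = multivariateGaussian 0 C) :
    HasGaussianLaw G P :=
  ⟨by rw [h]; infer_instance⟩

theorem integral_eval_of_map_eq (hG : Measurable G) (h : P.map G = multivariateGaussian 0 C)
    (i : ι) : ∫ ω, G ω i ∂P = 0 := by
  have hi : Integrable (fun x => x) (P.map G) := by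
    rw [h]; exact IsGaussian.integrable_id
  have h1 := (EuclideanSpace.proj (𝕜 := ℝ) i).integral_comp_comm hi
  rw [h, integral_id_multivariateGaussian, ← h, integral_map hG.aemeasurable
    (EuclideanSpace.proj (𝕜 := ℝ) i).continuous.aestronglyMeasurable] at h1
  simpa using h1

theorem covariance_eval_of_map_eq (hG : Measurable G) (h : P.map G = multivariateGaussian 0 C)
    (hC : C.PosSemidef) (i j : ι) : cov[fun ω => G ω i, fun ω => G ω j; P] = C i j := by
  have hm : ∀ i : ι, AEStronglyMeasurable (fun x : EuclideanSpace ℝ ι => x i) (P.map G) :=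
    fun i => (EuclideanSpace.proj (𝕜 := ℝ) i).continuous.aestronglyMeasurable
  rw [← covariance_eval_multivariateGaussian hC i j, ← h,
    covariance_map_fun (hm i) (hm j) hG.aemeasurable]

end MultivariateGaussian

section Existence

variable {M N : ℕ} (σ : Setting M)

/-- The covariance bookkeeping for `X = U - F S`. -/
theorem Setting.covU_sub (hS : σ.covSᵀ = σ.covS) :
    σ.covU - σ.F * σ.covSU - (σ.covSUᵀ - σ.F * σ.covS) * σ.Fᵀ = σ.covX := by
  simp only [Setting.covU, Setting.covSU, transpose_add, transpose_mul, transpose_transpose, hS]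
  noncomm_ring

/-- Sources of randomness for a jointly Gaussian assignment: `(S, U)`, `H` and `Z`. -/
abbrev GaussianSpace (M N : ℕ) : Type :=
  EuclideanSpace ℝ (Fin M ⊕ Fin M) × Matrix (Fin N) (Fin M) ℝ × EuclideanSpace ℝ (Fin N)

/-- The joint law of `(S, U)`, `H` and `Z` for a jointly Gaussian assignment. -/
def gaussianMeasure (ν : Measure (Matrix (Fin N) (Fin M) ℝ)) (covZ : Matrix (Fin N) (Fin N) ℝ) :
    Measure (GaussianSpace M N) :=
  (multivariateGaussian 0 σ.covSUJoint).prod (ν.prod (multivariateGaussian 0 covZ))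

variable (ν : Measure (Matrix (Fin N) (Fin M) ℝ)) [IsProbabilityMeasure ν]
  (covZ : Matrix (Fin N) (Fin N) ℝ)

instance : IsProbabilityMeasure (gaussianMeasure σ ν covZ) := by
  unfold gaussianMeasure; infer_instance

theorem map_fst_gaussianMeasure :
    (gaussianMeasure σ ν covZ).map Prod.fst = multivariateGaussian 0 σ.covSUJoint :=
  measurePreserving_fst.map_eq

theorem map_snd_gaussianMeasure :
    (gaussianMeasure σ ν covZ).map Prod.snd = ν.prod (multivariateGaussian 0 covZ) :=
  measurePreserving_snd.map_eq

theorem indepFun_fst_snd_gaussianMeasure :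
    IndepFun Prod.fst Prod.snd (gaussianMeasure σ ν covZ) :=
  indepFun_prod measurable_id measurable_id

/-- The first block of a vector, as a continuous linear map. -/
def blockFst : EuclideanSpace ℝ (Fin M ⊕ Fin M) →L[ℝ] (Fin M → ℝ) :=
  ContinuousLinearMap.pi fun i => EuclideanSpace.proj (Sum.inl i)

/-- The second block of a vector, as a continuous linear map. -/
def blockSnd : EuclideanSpace ℝ (Fin M ⊕ Fin M) →L[ℝ] (Fin M → ℝ) :=
  ContinuousLinearMap.pi fun i => EuclideanSpace.proj (Sum.inr i)

/-- The pair `(S, U)` is drawn first, since its covariance matrix is the one assumed positive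
definite. Setting `X = U - F S` then recovers `covSX` and `covX`. -/
theorem exists_isJointlyGaussian (hZ : covZ.PosDef) (hSU : σ.covSUJoint.PosDef) :
    ∃ a : LinearAssignment σ ν covZ (gaussianMeasure σ ν covZ), a.IsJointlyGaussian := by
  have hmap := map_fst_gaussianMeasure σ ν covZ
  have hind := indepFun_fst_snd_gaussianMeasure σ ν covZ
  have hmap2 := map_snd_gaussianMeasure σ ν covZ
  have hprob : IsProbabilityMeasure (gaussianMeasure σ ν covZ) := inferInstance
  -- From here on only the two marginals and their independence matter.
  generalize gaussianMeasure σ ν covZ = P at hmap hmap2 hprob hind ⊢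
  have hmapZ : P.map (fun ω => ω.2.2) = multivariateGaussian 0 covZ := by
    have := congrArg (Measure.map Prod.snd) hmap2
    rwa [Measure.map_map measurable_snd measurable_snd, measurePreserving_snd.map_eq] at this
  have hmapH : P.map (fun ω => ω.2.1) = ν := by
    have := congrArg (Measure.map Prod.fst) hmap2
    rwa [Measure.map_map measurable_fst measurable_snd, measurePreserving_fst.map_eq] at this
  have hmZ : Measurable fun ω : GaussianSpace M N => ω.2.2 := measurable_snd.comp measurable_snd
  have hG := hasGaussianLaw_of_map_eq hmap
  have hGZ := hasGaussianLaw_of_map_eq hmapZ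
  let FL := LinearMap.toContinuousLinearMap σ.F.mulVecLin
  let LX : EuclideanSpace ℝ (Fin M ⊕ Fin M) →L[ℝ] (Fin M → ℝ) := blockSnd - FL.comp blockFst
  have hLX : ∀ x, LX x = blockSnd x - σ.F *ᵥ blockFst x := fun x => rfl
  have hS2 := memLp_of_hasGaussianLaw (hG.map_fun (blockFst (M := M)))
  have hU2 := memLp_of_hasGaussianLaw (hG.map_fun (blockSnd (M := M)))
  have hX2 := memLp_of_hasGaussianLaw (hG.map_fun LX)
  have hFS2 := memLp_mulVec σ.F hS2
  have hcov := covariance_eval_of_map_eq measurable_fst hmap hSU.posSemidef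
  have hmean := integral_eval_of_map_eq measurable_fst hmap
  have hmS : ∀ i, ∫ ω, blockFst ω.1 i ∂P = 0 := fun i => hmean (Sum.inl i)
  have hmU : ∀ i, ∫ ω, blockSnd ω.1 i ∂P = 0 := fun i => hmean (Sum.inr i)
  have hSS : crossCov P (fun ω => blockFst ω.1) (fun ω => blockFst ω.1) = σ.covS := by
    ext i j; exact hcov (Sum.inl i) (Sum.inl j)
  have hSUc : crossCov P (fun ω => blockFst ω.1) (fun ω => blockSnd ω.1) = σ.covSU := by
    ext i j; exact hcov (Sum.inl i) (Sum.inr j)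
  have hUS : crossCov P (fun ω => blockSnd ω.1) (fun ω => blockFst ω.1) = σ.covSUᵀ := by
    ext i j; exact hcov (Sum.inr i) (Sum.inl j)
  have hUU : crossCov P (fun ω => blockSnd ω.1) (fun ω => blockSnd ω.1) = σ.covU := by
    ext i j; exact hcov (Sum.inr i) (Sum.inr j)
  have hSt : σ.covSᵀ = σ.covS := by rw [← hSS, crossCov_transpose]
  refine ⟨{ S := fun ω => blockFst ω.1
            X := fun ω => LX ω.1
            H := fun ω => ω.2.1
            Z := fun ω => (ω.2.2).ofLp
            measurable_S := by fun_prop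
            measurable_X := by fun_prop
            measurable_H := by fun_prop
            measurable_Z := by fun_prop
            gaussian_S := hG.map_fun blockFst
            mean_S := hmS
            cov_S := hSS
            memLp_X := hX2
            mean_X := ?_
            cov_X := ?_
            cov_SX := ?_
            law_H := hmapH
            gaussian_Z := hGZ.map_fun (EuclideanSpace.equiv (Fin N) ℝ).toContinuousLinearMap
            mean_Z := integral_eval_of_map_eq hmZ hmapZ
            cov_Z := ?_
            indep_SX_HZ := ?_
            indep_H_Z := ?_ }, ?_⟩
  · intro i
    have h1 := integral_mulVec_eq_zero σ.F (fun i => (hS2 i).integrable one_le_two) hmS i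
    have : ∫ ω, LX ω.1 i ∂P = ∫ ω, blockSnd ω.1 i ∂P - ∫ ω, (σ.F *ᵥ blockFst ω.1) i ∂P :=
      integral_sub ((hU2 i).integrable one_le_two) ((hFS2 i).integrable one_le_two)
    rw [this, h1, hmU, sub_zero]
  · simp only [hLX] at hX2 ⊢
    rw [crossCov_sub_left hU2 hFS2 hX2, crossCov_sub_right hU2 hU2 hFS2,
      crossCov_sub_right hFS2 hU2 hFS2, crossCov_mulVec_left _ hS2 hU2,
      crossCov_mulVec_left _ hS2 hFS2, crossCov_mulVec_right _ hU2 hS2,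
      crossCov_mulVec_right _ hS2 hS2, hUU, hUS, hSUc, hSS, ← σ.covU_sub hSt]
    noncomm_ring
  · simp only [hLX]
    rw [crossCov_sub_right hS2 hU2 hFS2, crossCov_mulVec_right _ hS2 hS2, hSUc, hSS,
      Setting.covSU, add_sub_cancel_left]
  · ext i j
    exact covariance_eval_of_map_eq hmZ hmapZ hZ.posSemidef i j
  · exact hind.comp (φ := fun x => (blockFst x, LX x))
      (ψ := fun y : Matrix (Fin N) (Fin M) ℝ × EuclideanSpace ℝ (Fin N) => (y.1, (y.2).ofLp))
      (by fun_prop) (by fun_prop)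
  · rw [indepFun_iff_map_prod_eq_prod_map_map (by fun_prop) (by fun_prop), hmapH]
    have hW : Measurable (WithLp.ofLp : EuclideanSpace ℝ (Fin N) → Fin N → ℝ) := by fun_prop
    have h1 := Measure.map_prod_map ν (multivariateGaussian 0 covZ) measurable_id hW
    rw [← hmap2, ← hmapZ, Measure.map_map (by fun_prop) measurable_snd, Measure.map_map hW hmZ,
      Measure.map_id] at h1
    exact h1.symm
  · exact hG.map_fun (blockFst.prod LX)

end Existence

/-! ### The capacity. -/

variable {M N : ℕ} {σ : Setting M} {ν : Measure (Matrix (Fin N) (Fin M) ℝ)}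
  [IsProbabilityMeasure ν] {covZ : Matrix (Fin N) (Fin N) ℝ}

theorem LinearAssignment.infoOutput_ne_top_and_rate_le {Ω : Type*} [MeasurableSpace Ω]
    {P : Measure Ω} [IsProbabilityMeasure P] (a : LinearAssignment σ ν covZ P)
    (hH : Integrable (fun h : Matrix (Fin N) (Fin M) ℝ => ∑ i, ∑ j, h i j ^ 2) ν)
    (hZ : covZ.PosDef) (hSU : σ.covSUJoint.PosDef)
    (hdet : Integrable (fun h => Real.log ((2 * Real.pi) • σ.errCov covZ h).det) ν)
    (hq : HasCondDensity P a.U a.S) :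
    a.infoOutput ≠ ⊤ ∧ a.rate ≤ (σ.gaussianRate ν covZ : ℝ) := by
  -- The auxiliary `g` may live on another probability space; it serves only to supply Bayes' rule
  -- for the Gaussian densities.
  obtain ⟨g, hg⟩ := exists_isJointlyGaussian σ ν covZ hZ hSU
  obtain ⟨q, hqm, hq1, h⟩ := hq
  rw [a.map_S hSU] at h
  have h1 := a.infoOutput_ne_top hH hZ hSU hqm h
  exact ⟨h1, a.rate_le_gaussianRate hZ hSU hdet (g.outputDensity_logDensityS_ae_eq hZ hSU hg)
    hqm hq1 h h1⟩

theorem linearAssignmentCapacity_eq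
    (hH : Integrable (fun h : Matrix (Fin N) (Fin M) ℝ => ∑ i, ∑ j, h i j ^ 2) ν)
    (hZ : covZ.PosDef) (hSU : σ.covSUJoint.PosDef)
    (hdet : Integrable (fun h => Real.log ((2 * Real.pi) • σ.errCov covZ h).det) ν) :
    linearAssignmentCapacity σ ν covZ = (σ.gaussianRate ν covZ : ℝ) := by
  refine le_antisymm (sSup_le ?_) (le_sSup ?_)
  · rintro r ⟨Ω, _, P, _, a, hq, rfl⟩
    exact (a.infoOutput_ne_top_and_rate_le hH hZ hSU hdet hq).2
  · obtain ⟨g, hg⟩ := exists_isJointlyGaussian σ ν covZ hZ hSU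
    have hq := LinearAssignment.hasCondDensity_of_gaussian hSU hg
    -- `GaussianSpace M N` lies in `Type`, the universe over which the supremum is taken.
    exact ⟨_, _, _, inferInstance, g, hq, LinearAssignment.rate_eq_gaussianRate hg hZ hSU hdet
      (g.infoOutput_ne_top_and_rate_le hH hZ hSU hdet hq).1⟩

end FadingPaper

end

theorem theorem1 {M N : ℕ} (σ : FadingPaper.Setting M)
    (ν : Measure (Matrix (Fin N) (Fin M) ℝ)) [IsProbabilityMeasure ν]
    (henergy : Integrable (fun h : Matrix (Fin N) (Fin M) ℝ => ∑ i, ∑ j, h i j ^ 2) ν)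
    (covZ : Matrix (Fin N) (Fin N) ℝ) (hcovZ : covZ.PosDef)
    (hfin : σ.FiniteExpectations ν covZ)
    (hnonsing : σ.covSUJoint.PosDef) :
    -- a jointly Gaussian choice exists and achieves the capacity
    (∃ (Ω : Type) (_ : MeasurableSpace Ω) (P : Measure Ω) (_ : IsProbabilityMeasure P)
      (a : FadingPaper.LinearAssignment σ ν covZ P),
      a.IsJointlyGaussian ∧ FadingPaper.HasCondDensity P a.U a.S ∧
        a.rate = FadingPaper.linearAssignmentCapacity σ ν covZ) ∧
    -- every admissible assignment has a well-defined rate, at most the capacity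
    (∀ {Ω : Type*} [MeasurableSpace Ω] (P : Measure Ω) [IsProbabilityMeasure P]
      (a : FadingPaper.LinearAssignment σ ν covZ P), FadingPaper.HasCondDensity P a.U a.S →
        a.infoOutput ≠ ⊤ ∧ a.rate ≤ FadingPaper.linearAssignmentCapacity σ ν covZ) ∧
    -- every jointly Gaussian choice achieves the capacity, with a finite rate
    (∀ {Ω : Type*} [MeasurableSpace Ω] (P : Measure Ω) [IsProbabilityMeasure P]
      (a : FadingPaper.LinearAssignment σ ν covZ P), a.IsJointlyGaussian →
        a.infoOutput ≠ ⊤ ∧ a.infoInterference ≠ ⊤ ∧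
          a.rate = FadingPaper.linearAssignmentCapacity σ ν covZ) := by
  have hdet := hfin.D_logdet
  rw [FadingPaper.linearAssignmentCapacity_eq henergy hcovZ hnonsing hdet]
  refine ⟨?_, fun P _ a => a.infoOutput_ne_top_and_rate_le henergy hcovZ hnonsing hdet,
    fun P _ a hg => ?_⟩
  · obtain ⟨g, hg⟩ := FadingPaper.exists_isJointlyGaussian σ ν covZ hcovZ hnonsing
    have hq := FadingPaper.LinearAssignment.hasCondDensity_of_gaussian hnonsing hg
    exact ⟨_, _, _, inferInstance, g, hg, hq, FadingPaper.LinearAssignment.rate_eq_gaussianRate hg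
      hcovZ hnonsing hdet (g.infoOutput_ne_top_and_rate_le henergy hcovZ hnonsing hdet hq).1⟩
  · have h1 := (a.infoOutput_ne_top_and_rate_le henergy hcovZ hnonsing hdet
      (FadingPaper.LinearAssignment.hasCondDensity_of_gaussian hnonsing hg)).1
    exact ⟨h1, FadingPaper.LinearAssignment.infoInterference_ne_top_of_gaussian hnonsing hg,
      FadingPaper.LinearAssignment.rate_eq_gaussianRate hg hcovZ hnonsing hdet h1⟩
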